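/- **Setting.** Let $Q$ be a finite-dimensional smooth manifold, $\tau_Q:TQ\to Q$ and $\pi_Q:T^*Q\to Q$ the projections, $\omega_Q=dq^A\wedge dp_A$ the canonical symplectic form of $T^*Q$. Let $L:TQ\to\mathbb R$ be smooth, with Legendre map $FL:TQ\to T^*Q$, energy $E_L=\Delta(L)-L$ and Poincaré–Cartan form $\omega_L=-d(S^*dL)$, where $S$ is the vertical endomorphism and $\Delta$ the Liouville vector field of $TQ$. Assume that $L$ is almost regular: $M_1=FL(TQ)$ is an (embedded) submanifold of $T^*Q$ and $FL:TQ\to M_1$ is a submersion with connected fibres. Let $h_1:M_1\to\mathbb R$ be the function with $h_1\circ FL=E_L$ and let $\omega_1$ be the pull-back of $\omega_Q$ to $M_1$. Put $$M_{l+1}=\{p\in M_l:\ \exists X_p\in T_pM_l,\ i_{X_p}\omega_1=dh_1(p)\},$$ and define similarly $P_1=TQ$ and $P_{l+1}=\{v\in P_l:\exists \xi_v\in T_vP_l,\ i_{\xi_v}\omega_L=dE_L(v)\}$. Assume that for some $k$ the sets $M_1,\dots,M_k$ are submanifolds and $M_{k+1}=M_k$; write $M_f=M_k$, $P_f=P_k$,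 and assume that $Q_f=\pi_Q(M_f)$ is a submanifold of $Q$. Let * $X$ be a smooth vector field on $M_f$ with $i_X\omega_1=dh_1$ at the points of $M_f$; * $\gamma$ be a smooth 1-form on $Q$ with $d\gamma=0$, $\gamma(Q)\subset M_1$, $\gamma(Q_f)\subset M_f$, and $d(h_1\circ\gamma)=0$ at every point of $Q_f$ (as a covector on $Q$); write $\gamma_f=\gamma|_{Q_f}$ and $X^\gamma=T\pi_Q\circ X\circ\gamma_f$; * $\xi$ be a smooth vector field on $P_f$ with $TFL\circ\xi=X\circ FL$ on $P_f$. For $p\in M_f$ put $\beta_\xi(p)=T\tau_Q(\xi(v))$ for any $v\in P_f$ with $FL(v)=p$, and define $X_\xi$ on $\operatorname{Im}\beta_\xi$ by $X_\xi(\beta_\xi(p))=T\beta_\xi(X(p))$. **Claim.** The map $\beta_\xi$ is a smooth section of $FL:P_f\to M_f$, and $X_\xi$ is the unique vector field on $\operatorname{Im}\beta_\xi$ (tangent to it) that satisfies both $i_{X_\xi}\omega_L=dE_L$ and the SODE condition $S X_\xi=\Delta$. Moreover $X^\gamma$ is a smooth vector field on $Q_f$, $\beta_\xi\circ\gamma_f=X^\gamma$,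 and $X_\xi$ and $X^\gamma$ are $X^\gamma$-related: for all $q\in Q_f$, $$X_\xi(\beta_\xi\circ\gamma_f(q))=TX^\gamma(X^\gamma(q))=(X^\gamma)^C(X^\gamma(q)),$$ where $(X^\gamma)^C$ is the complete lift of $X^\gamma$, that is, $TX^\gamma$ followed by the canonical involution of $TTQ$. In particular, for every $q\in Q_f$ the vector $w=TX^\gamma(X^\gamma(q))$ at the point $X^\gamma(q)\in TQ$ satisfies the Euler–Lagrange equation $i_w\omega_L=dE_L$ and the SODE condition $Sw=\Delta$. -/

import Mathlib

open Set Filter Topology Bundle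
open scoped Manifold ContDiff

noncomputable section

namespace SingularHJ

/-! ### Submanifolds, tangent vectors and exterior derivatives on a manifold without boundary -/

section General

variable {V : Type*} [NormedAddCommGroup V] [NormedSpace ℝ V]
  {H : Type*} [TopologicalSpace H] (I : ModelWithCorners ℝ V H)
  {N : Type*} [TopologicalSpace N] [ChartedSpace H N]

/-- `S` is an embedded smooth submanifold of `N`: around each of its points there is a smooth
chart of `N` in which `S` is a (translated) linear subspace. -/
def IsSubmanifold (S : Set N) : Prop :=
  ∀ p ∈ S, ∃ e ∈ IsManifold.maximalAtlas I ∞ N, p ∈ e.source ∧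
    ∃ F : Submodule ℝ V, ∀ x ∈ e.source, x ∈ S ↔ I (e x) - I (e p) ∈ F

/-- The tangent vectors to `S` at `p`: velocities at time `0` of smooth curves of `N` that start
at `p` and stay in `S`. -/
def tangentTo (S : Set N) (p : N) : Set (TangentSpace I p) :=
  {v | ∃ c : ℝ → N, (∀ᶠ t in 𝓝 (0 : ℝ), c t ∈ S) ∧ ContMDiffAt 𝓘(ℝ, ℝ) I ∞ c 0 ∧
    tangentMap 𝓘(ℝ, ℝ) I c ⟨0, (1 : ℝ)⟩ = ⟨p, v⟩}

/-- The exterior derivative of a 1-form `α` on `N`, computed at `x` in the preferred chart at `x`: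
`dα (u, v) = u (α v) - v (α u)` for vector fields `u`, `v` that are constant in the chart. -/
def extDer (α : ∀ x : N, TangentSpace I x →L[ℝ] ℝ) (x : N) (u v : TangentSpace I x) : ℝ :=
  let φ := extChartAt I x
  let a : V → V →L[ℝ] ℝ := fun y =>
    (α (φ.symm y)).comp
      (mfderivWithin 𝓘(ℝ, V) I φ.symm (range I) y : V →L[ℝ] TangentSpace I (φ.symm y))
  let u' : V := mfderiv I 𝓘(ℝ, V) φ x u
  let v' : V := mfderiv I 𝓘(ℝ, V) φ x v
  fderivWithin ℝ a (range I) (φ x) u' v' - fderivWithin ℝ a (range I) (φ x) v' u'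

/-- The constraint algorithm for the equation `i_X Ω = dh` on `M₁ ⊆ N`. Here `Ω` is a 2-form on
`N`, pulled back to `M₁`, and `h` is a function on `M₁`. Entry `l` of the sequence is the `(l+1)`-st
constraint set `M_{l+1}`. -/
def constraintSet (Ω : ∀ x : N, TangentSpace I x → TangentSpace I x → ℝ) (h : N → ℝ)
    (M₁ : Set N) : ℕ → Set N
  | 0 => M₁
  | l + 1 => {p ∈ constraintSet Ω h M₁ l | ∃ X ∈ tangentTo I (constraintSet Ω h M₁ l) p,
      ∀ Y ∈ tangentTo I M₁ p, Ω p X Y = mfderivWithin I 𝓘(ℝ, ℝ) h M₁ p Y}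

end General

/-! ### Geometry of the tangent and cotangent bundles -/

variable {E : Type*} [NormedAddCommGroup E] [NormedSpace ℝ E]
  {Q : Type*} [TopologicalSpace Q] [ChartedSpace E Q] [IsManifold 𝓘(ℝ, E) ∞ Q]

variable (E Q) in
/-- The tangent bundle `TQ`. -/
abbrev TB := TangentBundle 𝓘(ℝ, E) Q

variable (E Q) in
/-- The cotangent bundle `T*Q`. -/
abbrev CB := TotalSpace (E →L[ℝ] ℝ)
  (fun q : Q => TangentSpace 𝓘(ℝ, E) q →L[ℝ] Bundle.Trivial Q ℝ q)

variable (E) in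
/-- The model with corners of `TQ`. -/
abbrev IT : ModelWithCorners ℝ (E × E) (ModelProd E E) := 𝓘(ℝ, E).prod 𝓘(ℝ, E)

variable (E) in
/-- The model with corners of `T*Q`. -/
abbrev IC : ModelWithCorners ℝ (E × (E →L[ℝ] ℝ)) (ModelProd E (E →L[ℝ] ℝ)) :=
  𝓘(ℝ, E).prod 𝓘(ℝ, E →L[ℝ] ℝ)

variable (E Q) in
/-- The projection `τ_Q : TQ → Q`. -/
def tau (v : TB E Q) : Q := v.proj

variable (E Q) in
/-- The projection `π_Q : T*Q → Q`. -/
def proj (p : CB E Q) : Q := p.proj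

/-- The Liouville 1-form `θ = p_A dq^A` on `T*Q`. -/
def liouville (p : CB E Q) : TangentSpace (IC E) p →L[ℝ] ℝ :=
  ContinuousLinearMap.comp (p.2 : TangentSpace 𝓘(ℝ, E) p.proj →L[ℝ] ℝ)
    (mfderiv (IC E) 𝓘(ℝ, E) (proj E Q) p)

/-- The canonical symplectic form `ω_Q = -dθ = dq^A ∧ dp_A`. -/
def omegaQ (p : CB E Q) (X Y : TangentSpace (IC E) p) : ℝ :=
  -extDer (IC E) (liouville (E := E) (Q := Q)) p X Y

/-- The vertical lift `T_qQ → T_v(TQ)` at `v ∈ T_qQ`: the derivative at `v` of the inclusion of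
the fibre `T_qQ` in `TQ`. -/
def vlift (v : TB E Q) : TangentSpace 𝓘(ℝ, E) v.proj →L[ℝ] TangentSpace (IT E) v :=
  mfderiv 𝓘(ℝ, E) (IT E) (fun u : E => (⟨v.proj, u⟩ : TB E Q)) v.2

/-- The vertical endomorphism `S = dq^A ⊗ ∂/∂q̇^A`. -/
def vertEnd (v : TB E Q) : TangentSpace (IT E) v →L[ℝ] TangentSpace (IT E) v :=
  (vlift v).comp (mfderiv (IT E) 𝓘(ℝ, E) (tau E Q) v)

/-- The Liouville vector field `Δ = q̇^A ∂/∂q̇^A`. -/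
def liouvilleField (v : TB E Q) : TangentSpace (IT E) v := vlift v v.2

/-- The differential of the Lagrangian (or of another function on `TQ`). -/
def dTQ (L : TB E Q → ℝ) (v : TB E Q) : TangentSpace (IT E) v →L[ℝ] ℝ :=
  mfderiv (IT E) 𝓘(ℝ, ℝ) L v

/-- The 1-form `α_L = S^*(dL)`. -/
def alphaL (L : TB E Q → ℝ) (v : TB E Q) : TangentSpace (IT E) v →L[ℝ] ℝ :=
  (dTQ L v).comp (vertEnd v)

/-- The Poincaré-Cartan 2-form `ω_L = -dα_L`. -/
def omegaL (L : TB E Q → ℝ) (v : TB E Q) (X Y : TangentSpace (IT E) v) : ℝ :=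
  -extDer (IT E) (alphaL L) v X Y

/-- The energy `E_L = Δ(L) - L`. -/
def energy (L : TB E Q → ℝ) (v : TB E Q) : ℝ := dTQ L v (liouvilleField v) - L v

/-- The Legendre transformation `FL : TQ → T*Q`. One has `⟨FL(v), T τ_Q (Y)⟩ = α_L(v)(Y)`. -/
def FL (L : TB E Q → ℝ) (v : TB E Q) : CB E Q := ⟨v.proj, (dTQ L v).comp (vlift v)⟩

/-- The primary constraint set `M₁ = FL(TQ)`. -/
def primary (L : TB E Q → ℝ) : Set (CB E Q) := range (FL L)

/-- `L` is almost regular: `FL(TQ)` is a submanifold of `T*Q`, and `FL : TQ → FL(TQ)` is a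
submersion with connected fibres. -/
structure AlmostRegular (L : TB E Q → ℝ) : Prop where
  submanifold : IsSubmanifold (IC E) (primary L)
  submersion : ∀ v : TB E Q, ∀ Y ∈ tangentTo (IC E) (primary L) (FL L v),
    ∃ Z : TangentSpace (IT E) v, mfderiv (IT E) (IC E) (FL L) v Z = Y
  connected_fibres : ∀ p ∈ primary L, IsConnected (FL L ⁻¹' {p})

open Classical in
/-- The Hamiltonian `h₁` on `M₁` to which the energy projects: `h₁(p)` is the value of `E_L` at a
point of the fibre `FL⁻¹(p)`. Outside `M₁` its value is irrelevant. -/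
def hamiltonian₁ (L : TB E Q → ℝ) (p : CB E Q) : ℝ :=
  if h : ∃ v : TB E Q, FL L v = p then energy L h.choose else 0

/-- `X ∈ T_pM₁` satisfies `i_X ω₁ = dh₁` at `p`, where `ω₁` is the pull-back of `ω_Q` to `M₁`. -/
def SolvesHamilton (L : TB E Q → ℝ) (p : CB E Q) (X : TangentSpace (IC E) p) : Prop :=
  ∀ Y ∈ tangentTo (IC E) (primary L) p,
    omegaQ p X Y = mfderivWithin (IC E) 𝓘(ℝ, ℝ) (hamiltonian₁ L) (primary L) p Y

/-- `w ∈ T_v(TQ)` satisfies the Euler-Lagrange equation `i_w ω_L = dE_L` at `v`. -/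
def SolvesEL (L : TB E Q → ℝ) (v : TB E Q) (w : TangentSpace (IT E) v) : Prop :=
  ∀ Y : TangentSpace (IT E) v, omegaL L v w Y = dTQ (energy L) v Y

/-- `w ∈ T_v(TQ)` satisfies the SODE condition `S w = Δ` at `v`. -/
def IsSODE (v : TB E Q) (w : TangentSpace (IT E) v) : Prop :=
  vertEnd v w = liouvilleField v

/-- The Hamiltonian constraint sets `M₁, M₂, …` (numbered from `0`). -/
def M (L : TB E Q → ℝ) : ℕ → Set (CB E Q) :=
  constraintSet (IC E) omegaQ (hamiltonian₁ L) (primary L)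

/-- The Lagrangian constraint sets `P₁ = TQ, P₂, …` (numbered from `0`). -/
def P (L : TB E Q → ℝ) : ℕ → Set (TB E Q) :=
  constraintSet (IT E) (omegaL L) (energy L) univ

/-- `X` is a smooth vector field on the submanifold `S` of a manifold `N`: it is tangent to `S`
and smooth along `S`. Values outside `S` are irrelevant. -/
def IsFieldOn {V : Type*} [NormedAddCommGroup V] [NormedSpace ℝ V] {H : Type*}
    [TopologicalSpace H] (I : ModelWithCorners ℝ V H) {N : Type*} [TopologicalSpace N]
    [ChartedSpace H N] [IsManifold I 1 N] (S : Set N) (X : ∀ x : N, TangentSpace I x) : Prop :=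
  (∀ x ∈ S, X x ∈ tangentTo I S x) ∧
    ContMDiffOn I I.tangent ∞ (fun x => (⟨x, X x⟩ : TangentBundle I N)) S

/-- The vector field `X^γ = T π ∘ X ∘ γ` associated with a field `X` on `T*Q` and a 1-form `γ`. -/
def fieldOfForm (X : ∀ p : CB E Q, TangentSpace (IC E) p)
    (γ : ∀ q : Q, TangentSpace 𝓘(ℝ, E) q →L[ℝ] ℝ) (q : Q) : TangentSpace 𝓘(ℝ, E) q :=
  mfderiv (IC E) 𝓘(ℝ, E) (proj E Q) (⟨q, γ q⟩ : CB E Q) (X ⟨q, γ q⟩)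

/-- A vector field on `Q` as a map `Q → TQ`. -/
def asMap (Y : ∀ q : Q, TangentSpace 𝓘(ℝ, E) q) (q : Q) : TB E Q := ⟨q, Y q⟩

/-- A 1-form on `Q` as a map `Q → T*Q`. -/
def formAsMap (γ : ∀ q : Q, TangentSpace 𝓘(ℝ, E) q →L[ℝ] ℝ) (q : Q) : CB E Q := ⟨q, γ q⟩

open Classical in
/-- The map `β_ξ : M_f → P_f`, `β_ξ(p) = T τ_Q (ξ(v))` for any `v ∈ P_f` with `FL(v) = p`.
Its values outside `FL(P_f)` are irrelevant. -/
def beta (L : TB E Q → ℝ) (Pf : Set (TB E Q)) (ξ : ∀ v : TB E Q, TangentSpace (IT E) v)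
    (p : CB E Q) : TB E Q :=
  if h : ∃ v ∈ Pf, FL L v = p then
    tangentMap (IT E) 𝓘(ℝ, E) (tau E Q) ⟨h.choose, ξ h.choose⟩
  else ⟨p.proj, 0⟩

/-- The vector field `X_ξ` along `Im β_ξ`, given by `X_ξ(β(p)) = Tβ(X(p))`; here a point
`v = β(p)` determines `p = FL(v)`, since `β` is a section of `FL`. -/
def sodeField (L : TB E Q → ℝ) (Mf : Set (CB E Q)) (β : CB E Q → TB E Q)
    (X : ∀ p : CB E Q, TangentSpace (IC E) p) (v : TB E Q) : TangentBundle (IT E) (TB E Q) :=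
  tangentMapWithin (IC E) (IT E) β Mf ⟨FL L v, X (FL L v)⟩

/-- The canonical involution of `TTQ`. In the natural coordinates of `TTQ` induced by the
preferred chart of `Q` at the base point it is `(q, v, a, b) ↦ (q, a, v, b)`; these coordinates
are the ones by which Mathlib identifies `T_qQ` with `E` and `T_{(q,v)}TQ` with `E × E`. -/
def canonicalFlip (w : TangentBundle (IT E) (TB E Q)) : TangentBundle (IT E) (TB E Q) :=
  let ab : E × E := w.2
  let v : E := w.1.2
  ⟨⟨w.1.1, ab.1⟩, ((v, ab.2) : E × E)⟩

/-- The complete lift `Y^C` to `TS` of a vector field `Y` on a submanifold `S` of `Q`, that is, the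
tangent map of `Y` followed by the canonical involution; in coordinates
`Y^C = Y^A ∂/∂q^A + q̇^B (∂Y^A/∂q^B) ∂/∂q̇^A`. -/
def completeLift (S : Set Q) (Y : ∀ q : Q, TangentSpace 𝓘(ℝ, E) q) (v : TB E Q) : TangentBundle (IT E) (TB E Q) :=
  canonicalFlip (tangentMapWithin 𝓘(ℝ, E) (IT E) (asMap Y) S v)

end SingularHJ

end

set_option linter.unusedSectionVars false

noncomputable section

namespace SingularHJ

/-! ### Charts of a vector bundle over `Q` -/

section

variable {E : Type*} [NormedAddCommGroup E] [NormedSpace ℝ E]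
  {Q : Type*} [TopologicalSpace Q] [ChartedSpace E Q] [IsManifold 𝓘(ℝ, E) ∞ Q]

/-! In bundle charts `FL` reads $(q,\dot q)\mapsto(q,\partial L/\partial\dot q)$, and comparing
coordinate expressions gives $\omega_L=FL^*\omega_Q$ (`omegaL_eq_omegaQ`). The energy is constant on
the connected fibres, so $h_1\circ FL=E_L$ (`hamiltonian₁_FL`). Smooth local sections of `FL` lift
curves from $M_1$, whence $P_l=FL^{-1}(M_l)$ (`P_eq_preimage_M`), and a vector whose image under
$TFL$ solves Hamilton's equation solves the Euler–Lagrange equation.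

The crux is that $\beta_\xi$ is a section of `FL`. As `FL` covers the identity of $Q$,
$\beta_\xi(p)=a:=T\pi_Q(X(p))$, which depends on $p$ alone. Let $u$ be any point of the fibre of
`FL` over $p$. Pairing $i_X\omega_1=dh_1$ with the $TFL$-images of vertical vectors at $u$, and
using the symmetry of the fibre Hessian of $L$, shows that $a-u$ lies in the kernel of this Hessian
(`fderiv_mom_radial`). So the radial field $u\mapsto a-u$ is tangent to the fibre; a Grönwall
estimate keeps the segment from $u$ towards $a$ inside the fibre, and since the fibre is closed it
contains $a$ (`FL_eq_of_radial_tangent`).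

The rest is formal. From $FL\circ\beta_\xi=\mathrm{id}$ one gets $TFL(X_\xi)=X$, hence
Euler–Lagrange; the base component of $X_\xi$ at $\beta_\xi(p)$ is $a$, which is the SODE condition.
Two SODE solutions at one point have the same image under $TFL$, which is injective on vectors
tangent to $\operatorname{Im}\beta_\xi$ (`sodeField_unique_solution`). Closedness of $\gamma$ and
$d(h_1\circ\gamma)=0$ give $T\gamma(X^\gamma)=X\circ\gamma$ (`mfderiv_form_fieldOfForm`), so
differentiating $X^\gamma=\beta_\xi\circ\gamma$ along $X^\gamma$ yields $X_\xi$. The canonical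
involution fixes SODE vectors, whence the complete lift. -/

lemma triv_cotangent_apply (q : Q) (p : CB E Q) :
    (trivializationAt (E →L[ℝ] ℝ)
      (fun q : Q => TangentSpace 𝓘(ℝ, E) q →L[ℝ] Bundle.Trivial Q ℝ q) q p).2 =
    (p.2 : TangentSpace 𝓘(ℝ, E) p.proj →L[ℝ] ℝ).comp
      ((trivializationAt E (TangentSpace 𝓘(ℝ, E)) q).symmL ℝ p.proj) := by
  rw [hom_trivializationAt_apply]
  ext v
  simp [ContinuousLinearMap.inCoordinates]

section
variable {F : Type*} [NormedAddCommGroup F] [NormedSpace ℝ F] {V : Q → Type*}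
  [TopologicalSpace (TotalSpace F V)] [∀ x, TopologicalSpace (V x)] [∀ x, Zero (V x)] [FiberBundle F V]

lemma bundle_extChartAt_apply (z z' : TotalSpace F V)
    (h : z'.proj ∈ (trivializationAt F V z.proj).baseSet) :
    extChartAt (𝓘(ℝ, E).prod 𝓘(ℝ, F)) z z' =
      (extChartAt 𝓘(ℝ, E) z.proj z'.proj, (trivializationAt F V z.proj z').2) := by
  rw [FiberBundle.extChartAt]
  simp [Trivialization.coe_fst' _ h]

lemma bundle_mem_extChartAt_source (z z' : TotalSpace F V)
    (hb : (trivializationAt F V z.proj).baseSet = (chartAt E z.proj).source) :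
    z' ∈ (extChartAt (𝓘(ℝ, E).prod 𝓘(ℝ, F)) z).source ↔ z'.proj ∈ (chartAt E z.proj).source := by
  rw [FiberBundle.extChartAt]
  simp +contextual [Trivialization.mem_source, hb]

lemma bundle_mem_extChartAt_target (z : TotalSpace F V)
    (hb : (trivializationAt F V z.proj).baseSet = (chartAt E z.proj).source) (y : E × F) :
    y ∈ (extChartAt (𝓘(ℝ, E).prod 𝓘(ℝ, F)) z).target ↔ y.1 ∈ (extChartAt 𝓘(ℝ, E) z.proj).target := by
  rw [FiberBundle.extChartAt_target, hb]
  simp only [mem_prod, mem_inter_iff, mem_univ, and_true, mem_preimage, and_iff_left_iff_imp]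
  intro h
  simpa using (extChartAt 𝓘(ℝ, E) z.proj).map_target h

lemma bundle_extChartAt_symm_apply (z : TotalSpace F V)
    (hb : (trivializationAt F V z.proj).baseSet = (chartAt E z.proj).source) (y : E × F)
    (hy : y.1 ∈ (extChartAt 𝓘(ℝ, E) z.proj).target) :
    (extChartAt (𝓘(ℝ, E).prod 𝓘(ℝ, F)) z).symm y =
      ⟨(extChartAt 𝓘(ℝ, E) z.proj).symm y.1,
        (trivializationAt F V z.proj).symm ((extChartAt 𝓘(ℝ, E) z.proj).symm y.1) y.2⟩ := by
  rw [FiberBundle.extChartAt]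
  have := (extChartAt 𝓘(ℝ, E) z.proj).map_target hy
  rw [Trivialization.mk_symm _ (by rw [hb]; simpa using this)]
  simp
end

end

/-! ### Exterior derivatives of semibasic 1-forms -/

section

section ExteriorDerivative
variable {V : Type*} [NormedAddCommGroup V] [NormedSpace ℝ V]
  {H : Type*} [TopologicalSpace H] {I : ModelWithCorners ℝ V H}
  {N : Type*} [TopologicalSpace N] [ChartedSpace H N] [IsManifold I 1 N]

/-- The chart at `x` has the identity as its derivative at `x`, so the chart derivatives in the
definition disappear there, and only the germ of the coefficient function matters. -/
lemma extDer_eq_of_eventuallyEq (hI : range I = univ) (α : ∀ x : N, TangentSpace I x →L[ℝ] ℝ)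
    (x : N) (a : V → V →L[ℝ] ℝ)
    (ha : ∀ᶠ y in 𝓝 (extChartAt I x x), (α ((extChartAt I x).symm y)).comp
      (mfderivWithin 𝓘(ℝ, V) I (extChartAt I x).symm (range I) y :
        V →L[ℝ] TangentSpace I ((extChartAt I x).symm y)) = a y) (u v : V) :
    extDer I α x u v = fderiv ℝ a (extChartAt I x x) u v - fderiv ℝ a (extChartAt I x x) v u := by
  have h1 : mfderiv I 𝓘(ℝ, V) (extChartAt I x) x = ContinuousLinearMap.id ℝ _ :=
    mfderiv_extChartAt_self
  set f : V → V →L[ℝ] ℝ := fun y => (α ((extChartAt I x).symm y)).comp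
      (mfderivWithin 𝓘(ℝ, V) I (extChartAt I x).symm (range I) y :
        V →L[ℝ] TangentSpace I ((extChartAt I x).symm y))
  have hf : f =ᶠ[𝓝 (extChartAt I x x)] a := ha
  have h2 : fderivWithin ℝ f (range I) (extChartAt I x x) = fderiv ℝ a (extChartAt I x x) := by
    rw [hI, fderivWithin_univ]
    exact hf.fderiv_eq
  rw [← h2]
  have h3 : ∀ w : V, mfderiv I 𝓘(ℝ, V) (extChartAt I x) x w = w := fun w => by rw [h1]; rfl
  unfold extDer
  exact congrArg₂ (fun w₁ w₂ : V => fderivWithin ℝ f (range I) (extChartAt I x x) w₁ w₂ -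
    fderivWithin ℝ f (range I) (extChartAt I x x) w₂ w₁) (h3 u) (h3 v)

end ExteriorDerivative

variable {E : Type*} [NormedAddCommGroup E] [NormedSpace ℝ E]
  {Q : Type*} [TopologicalSpace Q] [ChartedSpace E Q] [IsManifold 𝓘(ℝ, E) ∞ Q]

section
variable {F : Type*} [NormedAddCommGroup F] [NormedSpace ℝ F] {V : Q → Type*}
  [TopologicalSpace (TotalSpace F V)] [∀ x, TopologicalSpace (V x)] [∀ x, Zero (V x)]
  [FiberBundle F V] [IsManifold (𝓘(ℝ, E).prod 𝓘(ℝ, F)) 1 (TotalSpace F V)]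

lemma mfderiv_proj_comp_mfderivWithin_symm (z : TotalSpace F V)
    (hb : (trivializationAt F V z.proj).baseSet = (chartAt E z.proj).source) (y : E × F)
    (hy : y.1 ∈ (extChartAt 𝓘(ℝ, E) z.proj).target) :
    (mfderiv (𝓘(ℝ, E).prod 𝓘(ℝ, F)) 𝓘(ℝ, E) (TotalSpace.proj : TotalSpace F V → Q)
        ((extChartAt (𝓘(ℝ, E).prod 𝓘(ℝ, F)) z).symm y)).comp
      (mfderivWithin 𝓘(ℝ, E × F) (𝓘(ℝ, E).prod 𝓘(ℝ, F))
        (extChartAt (𝓘(ℝ, E).prod 𝓘(ℝ, F)) z).symm (range (𝓘(ℝ, E).prod 𝓘(ℝ, F))) y) =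
    (mfderivWithin 𝓘(ℝ, E) 𝓘(ℝ, E) (extChartAt 𝓘(ℝ, E) z.proj).symm (range 𝓘(ℝ, E)) y.1).comp
      (ContinuousLinearMap.fst ℝ E F) := by
  have hr : range (𝓘(ℝ, E).prod 𝓘(ℝ, F)) = univ := by
    simp
  have hy' := (bundle_mem_extChartAt_target z hb y).2 hy
  have h1 : MDifferentiableAt 𝓘(ℝ, E × F) (𝓘(ℝ, E).prod 𝓘(ℝ, F))
      (extChartAt (𝓘(ℝ, E).prod 𝓘(ℝ, F)) z).symm y := by
    have := mdifferentiableWithinAt_extChartAt_symm hy'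
    rwa [hr, mdifferentiableWithinAt_univ] at this
  have h2 : MDifferentiableAt 𝓘(ℝ, E) 𝓘(ℝ, E) (extChartAt 𝓘(ℝ, E) z.proj).symm y.1 := by
    have := mdifferentiableWithinAt_extChartAt_symm hy
    rwa [ModelWithCorners.range_eq_univ, mdifferentiableWithinAt_univ] at this
  have h3 : MDifferentiableAt (𝓘(ℝ, E).prod 𝓘(ℝ, F)) 𝓘(ℝ, E)
      (TotalSpace.proj : TotalSpace F V → Q) ((extChartAt (𝓘(ℝ, E).prod 𝓘(ℝ, F)) z).symm y) :=
    (contMDiffAt_proj (n := 1) V).mdifferentiableAt one_ne_zero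
  have h4 : HasMFDerivAt 𝓘(ℝ, E × F) 𝓘(ℝ, E) (Prod.fst : E × F → E) y
      (ContinuousLinearMap.fst ℝ E F) := hasFDerivAt_fst.hasMFDerivAt
  rw [hr, mfderivWithin_univ, ModelWithCorners.range_eq_univ, mfderivWithin_univ]
  have h5 := h3.hasMFDerivAt.comp y h1.hasMFDerivAt
  have h6 := HasMFDerivAt.comp y h2.hasMFDerivAt h4
  refine hasMFDerivAt_unique h5 (h6.congr_of_eventuallyEq ?_)
  have h7 : ∀ᶠ y' : E × F in 𝓝 y, y'.1 ∈ (extChartAt 𝓘(ℝ, E) z.proj).target :=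
    continuousAt_fst.eventually ((isOpen_extChartAt_target z.proj).mem_nhds hy)
  filter_upwards [h7] with y' hy'
  change ((extChartAt (𝓘(ℝ, E).prod 𝓘(ℝ, F)) z).symm y').proj = _
  rw [bundle_extChartAt_symm_apply z hb y' hy']
  rfl

/-- A semibasic form has only $dq$-components $n$ in a bundle chart, so its differential is
$dn\wedge dq$. The Liouville form ($n$ is the fibre coordinate) and $\alpha_L$ ($n$ is the momentum)
are both of this kind, so one computation yields $\omega_Q$ and $\omega_L$. -/
lemma extDer_semibasic (z : TotalSpace F V)
    (hb : (trivializationAt F V z.proj).baseSet = (chartAt E z.proj).source)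
    (μ : ∀ z : TotalSpace F V, TangentSpace 𝓘(ℝ, E) z.proj →L[ℝ] ℝ) (n : E × F → E →L[ℝ] ℝ)
    (hn : DifferentiableAt ℝ n (extChartAt (𝓘(ℝ, E).prod 𝓘(ℝ, F)) z z))
    (hμ : ∀ y : E × F, y.1 ∈ (extChartAt 𝓘(ℝ, E) z.proj).target →
      (μ ((extChartAt (𝓘(ℝ, E).prod 𝓘(ℝ, F)) z).symm y)).comp
        ((trivializationAt E (TangentSpace 𝓘(ℝ, E)) z.proj).symmL ℝ
          ((extChartAt (𝓘(ℝ, E).prod 𝓘(ℝ, F)) z).symm y).proj) = n y)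
    (A B : E × F) :
    extDer (𝓘(ℝ, E).prod 𝓘(ℝ, F)) (fun z => (μ z).comp
        (mfderiv (𝓘(ℝ, E).prod 𝓘(ℝ, F)) 𝓘(ℝ, E) (TotalSpace.proj : TotalSpace F V → Q) z)) z A B =
      fderiv ℝ n (extChartAt (𝓘(ℝ, E).prod 𝓘(ℝ, F)) z z) A B.1 -
        fderiv ℝ n (extChartAt (𝓘(ℝ, E).prod 𝓘(ℝ, F)) z z) B A.1 := by
  have hr : range (𝓘(ℝ, E).prod 𝓘(ℝ, F)) = univ := by
    simp
  rw [extDer_eq_of_eventuallyEq hr _ z (fun y => (n y).comp (ContinuousLinearMap.fst ℝ E F))]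
  · have h : ∀ C D : E × F, fderiv ℝ (fun y => (n y).comp (ContinuousLinearMap.fst ℝ E F))
        (extChartAt (𝓘(ℝ, E).prod 𝓘(ℝ, F)) z z) C D =
        fderiv ℝ n (extChartAt (𝓘(ℝ, E).prod 𝓘(ℝ, F)) z z) C D.1 := by
      intro C D
      rw [(hn.hasFDerivAt.clm_comp (hasFDerivAt_const _ _)).fderiv]
      simp
    rw [h, h]
  · filter_upwards [extChartAt_target_mem_nhds (I := 𝓘(ℝ, E).prod 𝓘(ℝ, F)) z] with y hy
    rw [bundle_mem_extChartAt_target z hb] at hy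
    have h1 := mfderiv_proj_comp_mfderivWithin_symm z hb y hy
    have hp : ((extChartAt (𝓘(ℝ, E).prod 𝓘(ℝ, F)) z).symm y).proj =
        (extChartAt 𝓘(ℝ, E) z.proj).symm y.1 := by
      rw [bundle_extChartAt_symm_apply z hb y hy]
    have h2 := TangentBundle.symmL_trivializationAt (I := 𝓘(ℝ, E)) (x₀ := z.proj)
      (x := ((extChartAt (𝓘(ℝ, E).prod 𝓘(ℝ, F)) z).symm y).proj)
      (by rw [hp]; simpa using (extChartAt 𝓘(ℝ, E) z.proj).map_target hy)
    have h3 : extChartAt 𝓘(ℝ, E) z.proj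
        ((extChartAt (𝓘(ℝ, E).prod 𝓘(ℝ, F)) z).symm y).proj = y.1 := by
      rw [hp, (extChartAt 𝓘(ℝ, E) z.proj).right_inv hy]
    rw [h3] at h2
    ext C : 1
    rw [← hμ y hy]
    have h4 := DFunLike.congr_fun h1 C
    have h5 := DFunLike.congr_fun h2 C.1
    exact congrArg (μ _) (h4.trans h5.symm)
end

end

/-! ### Natural coordinates on $TQ$ and $T^*Q$ -/

section

section LocalDerivative
variable {V : Type*} [NormedAddCommGroup V] [NormedSpace ℝ V]
  {H : Type*} [TopologicalSpace H] {I : ModelWithCorners ℝ V H}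
  {N : Type*} [TopologicalSpace N] [ChartedSpace H N]
  {V' : Type*} [NormedAddCommGroup V'] [NormedSpace ℝ V']
  {H' : Type*} [TopologicalSpace H'] {I' : ModelWithCorners ℝ V' H'}
  {N' : Type*} [TopologicalSpace N'] [ChartedSpace H' N']

lemma hasMFDerivAt_of_written {f : N → N'} {x : N} {g : V → V'} {g' : V →L[ℝ] V'}
    (hf : ContinuousAt f x) (hg : HasFDerivAt g g' (extChartAt I x x))
    (h : ∀ᶠ y in 𝓝 (extChartAt I x x), extChartAt I' (f x) (f ((extChartAt I x).symm y)) = g y) :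
    HasMFDerivAt I I' f x g' :=
  ⟨hf, (hg.congr_of_eventuallyEq h).hasFDerivWithinAt⟩

end LocalDerivative

variable {E : Type*} [NormedAddCommGroup E] [NormedSpace ℝ E]
  {Q : Type*} [TopologicalSpace Q] [ChartedSpace E Q] [IsManifold 𝓘(ℝ, E) ∞ Q]

/-- The chart of `TQ` induced by the preferred chart of `Q` at `q`. -/
def tchart (q : Q) : PartialEquiv (TB E Q) (E × E) := extChartAt (IT E) (⟨q, 0⟩ : TB E Q)

/-- The chart of `T*Q` induced by the preferred chart of `Q` at `q`. -/
def cchart (q : Q) : PartialEquiv (CB E Q) (E × (E →L[ℝ] ℝ)) :=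
  extChartAt (IC E) (⟨q, 0⟩ : CB E Q)

lemma extChartAt_tangent (v : TB E Q) : extChartAt (IT E) v = tchart v.proj := by
  rw [tchart, FiberBundle.extChartAt, FiberBundle.extChartAt]

lemma extChartAt_cotangent (p : CB E Q) : extChartAt (IC E) p = cchart p.proj := by
  rw [cchart, FiberBundle.extChartAt, FiberBundle.extChartAt]

lemma tangent_baseSet (q : Q) :
    (trivializationAt E (TangentSpace 𝓘(ℝ, E)) q).baseSet = (chartAt E q).source := rfl

lemma cotangent_baseSet (q : Q) :
    (trivializationAt (E →L[ℝ] ℝ)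
      (fun q : Q => TangentSpace 𝓘(ℝ, E) q →L[ℝ] Bundle.Trivial Q ℝ q) q).baseSet =
      (chartAt E q).source := by
  simp [hom_trivializationAt_baseSet]

lemma mem_tchart_source (q : Q) (v : TB E Q) :
    v ∈ (tchart q).source ↔ v.proj ∈ (chartAt E q).source :=
  bundle_mem_extChartAt_source (⟨q, 0⟩ : TB E Q) v (tangent_baseSet q)

lemma mem_cchart_source (q : Q) (p : CB E Q) :
    p ∈ (cchart q).source ↔ p.proj ∈ (chartAt E q).source :=
  bundle_mem_extChartAt_source (⟨q, 0⟩ : CB E Q) p (cotangent_baseSet q)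

lemma mem_tchart_target (q : Q) (y : E × E) :
    y ∈ (tchart q).target ↔ y.1 ∈ (extChartAt 𝓘(ℝ, E) q).target :=
  bundle_mem_extChartAt_target (⟨q, 0⟩ : TB E Q) (tangent_baseSet q) y

lemma mem_cchart_target (q : Q) (y : E × (E →L[ℝ] ℝ)) :
    y ∈ (cchart q).target ↔ y.1 ∈ (extChartAt 𝓘(ℝ, E) q).target :=
  bundle_mem_extChartAt_target (⟨q, 0⟩ : CB E Q) (cotangent_baseSet q) y

/-- This makes the fibre coordinate of a vector at `q` equal to the vector itself, regarded as an
element of `E`, so pointwise formulas need no transition maps. -/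
lemma symmL_self (q : Q) :
    (trivializationAt E (TangentSpace 𝓘(ℝ, E)) q).symmL ℝ q = ContinuousLinearMap.id ℝ E := by
  rw [TangentBundle.symmL_trivializationAt (mem_chart_source E q)]
  exact mfderivWithin_range_extChartAt_symm

lemma tchart_symm_apply (q : Q) (y : E × E) (hy : y.1 ∈ (extChartAt 𝓘(ℝ, E) q).target) :
    (tchart q).symm y = ⟨(extChartAt 𝓘(ℝ, E) q).symm y.1,
      (trivializationAt E (TangentSpace 𝓘(ℝ, E)) q).symmL ℝ ((extChartAt 𝓘(ℝ, E) q).symm y.1)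
        y.2⟩ := by
  have h := bundle_extChartAt_symm_apply (⟨q, 0⟩ : TB E Q) (tangent_baseSet q) y hy
  rw [← Trivialization.symmL_apply (R := ℝ)] at h
  · exact h
  · rw [tangent_baseSet]
    simpa using (extChartAt 𝓘(ℝ, E) q).map_target hy

lemma proj_cchart_symm (q : Q) (y : E × (E →L[ℝ] ℝ)) (hy : y.1 ∈ (extChartAt 𝓘(ℝ, E) q).target) :
    ((cchart q).symm y).proj = (extChartAt 𝓘(ℝ, E) q).symm y.1 := by
  rw [cchart, bundle_extChartAt_symm_apply (⟨q, 0⟩ : CB E Q) (cotangent_baseSet q) y hy]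

lemma tchart_apply (q : Q) (v : TB E Q) (hv : v.proj ∈ (chartAt E q).source) :
    tchart q v = (extChartAt 𝓘(ℝ, E) q v.proj,
      (trivializationAt E (TangentSpace 𝓘(ℝ, E)) q v).2) :=
  bundle_extChartAt_apply (⟨q, 0⟩ : TB E Q) v hv

lemma cchart_apply (q : Q) (p : CB E Q) (hp : p.proj ∈ (chartAt E q).source) :
    cchart q p = (extChartAt 𝓘(ℝ, E) q p.proj,
      (p.2 : TangentSpace 𝓘(ℝ, E) p.proj →L[ℝ] ℝ).comp
        ((trivializationAt E (TangentSpace 𝓘(ℝ, E)) q).symmL ℝ p.proj)) := by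
  rw [← triv_cotangent_apply]
  exact bundle_extChartAt_apply (⟨q, 0⟩ : CB E Q) p (by rwa [cotangent_baseSet])

lemma tchart_self (q : Q) (u : E) :
    tchart q (⟨q, u⟩ : TB E Q) = (extChartAt 𝓘(ℝ, E) q q, u) := by
  have h : (⟨q, u⟩ : TB E Q) = (tchart q).symm (extChartAt 𝓘(ℝ, E) q q, u) := by
    rw [tchart_symm_apply q _ (mem_extChartAt_target q)]
    have h' : ∀ b : Q, b = q → (⟨q, u⟩ : TB E Q) =
        ⟨b, (trivializationAt E (TangentSpace 𝓘(ℝ, E)) q).symmL ℝ b u⟩ := by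
      rintro b rfl
      rw [symmL_self]
      rfl
    exact h' _ (extChartAt_to_inv q)
  rw [h, (tchart q).right_inv]
  rw [mem_tchart_target]
  exact mem_extChartAt_target q

lemma hasMFDerivAt_tau (v : TB E Q) :
    HasMFDerivAt (IT E) 𝓘(ℝ, E) (tau E Q) v (ContinuousLinearMap.fst ℝ E E) := by
  refine hasMFDerivAt_of_written (g := Prod.fst) ?_ hasFDerivAt_fst ?_
  · exact (contMDiffAt_proj (n := 1) (IB := 𝓘(ℝ, E)) _).continuousAt
  · filter_upwards [extChartAt_target_mem_nhds (I := IT E) v] with y hy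
    rw [extChartAt_tangent] at hy ⊢
    rw [mem_tchart_target] at hy
    rw [tchart_symm_apply _ _ hy]
    exact (extChartAt 𝓘(ℝ, E) v.proj).right_inv hy

lemma hasMFDerivAt_proj (p : CB E Q) :
    HasMFDerivAt (IC E) 𝓘(ℝ, E) (proj E Q) p (ContinuousLinearMap.fst ℝ E (E →L[ℝ] ℝ)) := by
  refine hasMFDerivAt_of_written (g := Prod.fst) ?_ hasFDerivAt_fst ?_
  · exact (contMDiffAt_proj (n := 1) (IB := 𝓘(ℝ, E)) _).continuousAt
  · filter_upwards [extChartAt_target_mem_nhds (I := IC E) p] with y hy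
    rw [extChartAt_cotangent] at hy ⊢
    rw [mem_cchart_target] at hy
    change extChartAt 𝓘(ℝ, E) p.proj ((cchart p.proj).symm y).proj = _
    rw [proj_cchart_symm _ _ hy]
    exact (extChartAt 𝓘(ℝ, E) p.proj).right_inv hy

lemma contMDiff_projection : ContMDiff (IC E) 𝓘(ℝ, E) ∞ (proj E Q) := contMDiff_proj _

lemma contMDiff_fibre_inclusion (q : Q) :
    ContMDiff 𝓘(ℝ, E) (IT E) ∞ (fun u : E => (⟨q, u⟩ : TB E Q)) := by
  intro u
  rw [contMDiffAt_totalSpace]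
  refine ⟨contMDiffAt_const, ?_⟩
  have : (fun u : E => ((trivializationAt E (TangentSpace 𝓘(ℝ, E)) q) (⟨q, u⟩ : TB E Q)).2) = id := by
    funext u
    have h := tchart_apply q (⟨q, u⟩ : TB E Q) (mem_chart_source E q)
    exact (congrArg Prod.snd ((tchart_self q u).symm.trans h)).symm
  rw [this]
  exact contMDiffAt_id

lemma hasMFDerivAt_fibre_inclusion (v : TB E Q) :
    HasMFDerivAt 𝓘(ℝ, E) (IT E) (fun u : E => (⟨v.proj, u⟩ : TB E Q)) v.2
      (ContinuousLinearMap.inr ℝ E E) := by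
  refine hasMFDerivAt_of_written (g := fun u => (extChartAt 𝓘(ℝ, E) v.proj v.proj, u))
    (contMDiff_fibre_inclusion v.proj).continuous.continuousAt ?_ ?_
  · exact hasFDerivAt_prodMk_right _ _
  · refine Eventually.of_forall fun u => ?_
    rw [extChartAt_tangent]
    exact tchart_self v.proj u

lemma vlift_apply (v : TB E Q) (u : E) : vlift v u = ((0, u) : E × E) := by
  rw [vlift, (hasMFDerivAt_fibre_inclusion v).mfderiv]
  rfl

/-- In coordinates $S(a,b)=(0,a)$ and $\Delta=(0,\dot q)$. -/
lemma isSODE_iff (v : TB E Q) (w : E × E) : IsSODE v w ↔ w.1 = v.2 := by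
  have h1 : vertEnd v w = ((0, w.1) : E × E) := by
    rw [vertEnd, (hasMFDerivAt_tau v).mfderiv]
    exact vlift_apply v w.1
  have h2 : liouvilleField v = ((0, v.2) : E × E) := vlift_apply v v.2
  unfold IsSODE
  rw [h1, h2]
  exact ⟨fun h => congrArg Prod.snd h, fun h => by rw [h]⟩

end

/-! ### The Lagrangian, its Legendre map and $\omega_L$ in coordinates -/

section

variable {E : Type*} [NormedAddCommGroup E] [NormedSpace ℝ E]
  {Q : Type*} [TopologicalSpace Q] [ChartedSpace E Q] [IsManifold 𝓘(ℝ, E) ∞ Q]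

/-- The Lagrangian in the chart of `TQ` induced by the preferred chart at `q`. -/
def lag (L : TB E Q → ℝ) (q : Q) (y : E × E) : ℝ := L ((tchart q).symm y)

/-- The momenta `∂L/∂q̇` in the chart induced by the preferred chart at `q`. -/
def mom (L : TB E Q → ℝ) (q : Q) (y : E × E) : E →L[ℝ] ℝ :=
  (fderiv ℝ (lag L q) y).comp (ContinuousLinearMap.inr ℝ E E)

lemma isOpen_tchart_target (q : Q) : IsOpen (tchart (E := E) q).target :=
  isOpen_extChartAt_target _

lemma isOpen_cchart_target (q : Q) : IsOpen (cchart (E := E) q).target :=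
  isOpen_extChartAt_target _

lemma contMDiffAt_tchart_symm (q : Q) {y : E × E} (hy : y ∈ (tchart q).target) :
    ContMDiffAt 𝓘(ℝ, E × E) (IT E) ∞ (tchart q).symm y :=
  (contMDiffOn_extChartAt_symm (n := ∞) (I := IT E) (⟨q, 0⟩ : TB E Q)).contMDiffAt
    ((isOpen_tchart_target q).mem_nhds hy)

lemma contMDiffAt_cchart_symm (q : Q) {y : E × (E →L[ℝ] ℝ)} (hy : y ∈ (cchart q).target) :
    ContMDiffAt 𝓘(ℝ, E × (E →L[ℝ] ℝ)) (IC E) ∞ (cchart q).symm y :=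
  (contMDiffOn_extChartAt_symm (n := ∞) (I := IC E) (⟨q, 0⟩ : CB E Q)).contMDiffAt
    ((isOpen_cchart_target q).mem_nhds hy)

lemma contMDiffAt_tchart (q : Q) {v : TB E Q} (hv : v.proj ∈ (chartAt E q).source) :
    ContMDiffAt (IT E) 𝓘(ℝ, E × E) ∞ (tchart q) v := by
  refine contMDiffAt_extChartAt' (x := (⟨q, 0⟩ : TB E Q)) ?_
  rw [← extChartAt_source (IT E)]
  exact (mem_tchart_source q v).2 hv

lemma contMDiffAt_cchart (q : Q) {p : CB E Q} (hp : p.proj ∈ (chartAt E q).source) :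
    ContMDiffAt (IC E) 𝓘(ℝ, E × (E →L[ℝ] ℝ)) ∞ (cchart q) p := by
  refine contMDiffAt_extChartAt' (x := (⟨q, 0⟩ : CB E Q)) ?_
  rw [← extChartAt_source (IC E)]
  exact (mem_cchart_source q p).2 hp

lemma contDiffOn_lag {L : TB E Q → ℝ} (hL : ContMDiff (IT E) 𝓘(ℝ, ℝ) ∞ L) (q : Q) :
    ContDiffOn ℝ ∞ (lag L q) (tchart q).target := fun y hy =>
  ((hL.contMDiffAt.comp y (contMDiffAt_tchart_symm q hy)).contDiffAt).contDiffWithinAt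

lemma contDiffOn_mom {L : TB E Q → ℝ} (hL : ContMDiff (IT E) 𝓘(ℝ, ℝ) ∞ L) (q : Q) :
    ContDiffOn ℝ ∞ (mom L q) (tchart q).target :=
  ((contDiffOn_lag hL q).fderiv_of_isOpen (isOpen_tchart_target q) le_rfl).clm_comp
    contDiffOn_const

lemma contDiffAt_mom {L : TB E Q → ℝ} (hL : ContMDiff (IT E) 𝓘(ℝ, ℝ) ∞ L) (q : Q) {y : E × E}
    (hy : y ∈ (tchart q).target) : ContDiffAt ℝ ∞ (mom L q) y :=
  (contDiffOn_mom hL q).contDiffAt ((isOpen_tchart_target q).mem_nhds hy)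

lemma contDiffAt_lag {L : TB E Q → ℝ} (hL : ContMDiff (IT E) 𝓘(ℝ, ℝ) ∞ L) (q : Q) {y : E × E}
    (hy : y ∈ (tchart q).target) : ContDiffAt ℝ ∞ (lag L q) y :=
  (contDiffOn_lag hL q).contDiffAt ((isOpen_tchart_target q).mem_nhds hy)

/-- Both sides are the derivative of $L$ along the fibre, computed once in the chart and once by the
chain rule through the linear trivialization. It identifies the intrinsic `FL` with $\partial
L/\partial\dot q$. -/
lemma mom_eq {L : TB E Q → ℝ} (hL : ContMDiff (IT E) 𝓘(ℝ, ℝ) ∞ L) (q : Q) {y : E × E}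
    (hy : y ∈ (tchart q).target) :
    mom L q y = ((FL L ((tchart q).symm y)).2 :
        TangentSpace 𝓘(ℝ, E) ((tchart q).symm y).proj →L[ℝ] ℝ).comp
      ((trivializationAt E (TangentSpace 𝓘(ℝ, E)) q).symmL ℝ ((tchart q).symm y).proj) := by
  have hy1 : y.1 ∈ (extChartAt 𝓘(ℝ, E) q).target := (mem_tchart_target q y).1 hy
  rw [tchart_symm_apply q y hy1]
  set b := (extChartAt 𝓘(ℝ, E) q).symm y.1 with hb
  set σ : E →L[ℝ] E := (trivializationAt E (TangentSpace 𝓘(ℝ, E)) q).symmL ℝ b with hσ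
  set v : TB E Q := ⟨b, σ y.2⟩ with hv
  have h1 : HasMFDerivAt 𝓘(ℝ, E) (IT E) (fun u : E => (⟨b, u⟩ : TB E Q)) (σ y.2) (vlift v) :=
    ((contMDiff_fibre_inclusion b).mdifferentiable (by simp) _).hasMFDerivAt
  have h2 : HasMFDerivAt (IT E) 𝓘(ℝ, ℝ) L v (dTQ L v) :=
    (hL.mdifferentiable (by simp) v).hasMFDerivAt
  have h3 : HasMFDerivAt 𝓘(ℝ, E) 𝓘(ℝ, E) σ y.2 σ := σ.hasFDerivAt.hasMFDerivAt
  have h4 := (HasMFDerivAt.comp y.2 (HasMFDerivAt.comp (σ y.2) h2 h1) h3).hasFDerivAt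
  have h5 : HasFDerivAt (fun u => lag L q (y.1, u)) (mom L q y) y.2 :=
    HasFDerivAt.comp (f := fun u : E => (y.1, u)) y.2
      ((contDiffAt_lag hL q hy).differentiableAt (by simp)).hasFDerivAt
      (hasFDerivAt_prodMk_right y.1 y.2)
  refine h5.unique (h4.congr_of_eventuallyEq (Eventually.of_forall fun u => ?_))
  change L ((tchart q).symm (y.1, u)) = L _
  rw [tchart_symm_apply q (y.1, u) hy1]
  rfl

lemma cchart_FL {L : TB E Q → ℝ} (hL : ContMDiff (IT E) 𝓘(ℝ, ℝ) ∞ L) (q : Q) {y : E × E}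
    (hy : y ∈ (tchart q).target) :
    cchart q (FL L ((tchart q).symm y)) = (y.1, mom L q y) := by
  have hy1 : y.1 ∈ (extChartAt 𝓘(ℝ, E) q).target := (mem_tchart_target q y).1 hy
  have h0 : (FL L ((tchart q).symm y)).proj = (extChartAt 𝓘(ℝ, E) q).symm y.1 := by
    rw [tchart_symm_apply q y hy1]; rfl
  rw [cchart_apply, mom_eq hL q hy]
  · rw [h0, (extChartAt 𝓘(ℝ, E) q).right_inv hy1]
    rfl
  · rw [h0]
    simpa using (extChartAt 𝓘(ℝ, E) q).map_target hy1

lemma FL_tchart_symm {L : TB E Q → ℝ} (hL : ContMDiff (IT E) 𝓘(ℝ, ℝ) ∞ L) (q : Q) {y : E × E}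
    (hy : y ∈ (tchart q).target) :
    FL L ((tchart q).symm y) = (cchart q).symm (y.1, mom L q y) := by
  rw [← cchart_FL hL q hy, (cchart q).left_inv]
  rw [mem_cchart_source]
  exact (mem_tchart_source q _).1 ((tchart q).map_target hy)

lemma contMDiff_FL {L : TB E Q → ℝ} (hL : ContMDiff (IT E) 𝓘(ℝ, ℝ) ∞ L) :
    ContMDiff (IT E) (IC E) ∞ (FL L) := by
  intro v
  have hv : v ∈ (tchart v.proj).source := (mem_tchart_source _ _).2 (mem_chart_source E _)
  have ht : tchart v.proj v ∈ (tchart v.proj).target := (tchart v.proj).map_source hv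
  have h1 : ContMDiffAt (IT E) 𝓘(ℝ, E × (E →L[ℝ] ℝ)) ∞
      (fun w : TB E Q => ((tchart v.proj w).1, mom L v.proj (tchart v.proj w))) v :=
    ((contDiffAt_fst.prodMk (contDiffAt_mom hL v.proj ht)).contMDiffAt).comp v
      (contMDiffAt_tchart v.proj (mem_chart_source E _))
  have h2 := (contMDiffAt_cchart_symm v.proj (y := ((tchart v.proj v).1,
    mom L v.proj (tchart v.proj v))) (by
      rw [mem_cchart_target]; exact (mem_tchart_target _ _).1 ht)).comp v h1
  refine h2.congr_of_eventuallyEq ?_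
  filter_upwards [(isOpen_extChartAt_source (I := IT E) v).mem_nhds
    (mem_extChartAt_source v)] with w hw
  rw [extChartAt_tangent] at hw
  have h3 := FL_tchart_symm hL v.proj ((tchart v.proj).map_source hw)
  rw [(tchart v.proj).left_inv hw] at h3
  exact h3

lemma tchart_self_mem (v : TB E Q) : tchart v.proj v ∈ (tchart v.proj).target :=
  (tchart v.proj).map_source ((mem_tchart_source _ _).2 (mem_chart_source E _))

lemma hasMFDerivAt_FL {L : TB E Q → ℝ} (hL : ContMDiff (IT E) 𝓘(ℝ, ℝ) ∞ L) (v : TB E Q) :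
    HasMFDerivAt (IT E) (IC E) (FL L) v
      ((ContinuousLinearMap.fst ℝ E E).prod (fderiv ℝ (mom L v.proj) (tchart v.proj v))) := by
  refine hasMFDerivAt_of_written (g := fun y => (y.1, mom L v.proj y))
    (contMDiff_FL hL).continuous.continuousAt ?_ ?_
  · rw [extChartAt_tangent]
    exact hasFDerivAt_fst.prodMk
      ((contDiffAt_mom hL _ (tchart_self_mem v)).differentiableAt (by simp)).hasFDerivAt
  · filter_upwards [extChartAt_target_mem_nhds (I := IT E) v] with y hy
    rw [extChartAt_tangent] at hy ⊢
    rw [extChartAt_cotangent]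
    exact cchart_FL hL v.proj hy

lemma mfderiv_FL {L : TB E Q → ℝ} (hL : ContMDiff (IT E) 𝓘(ℝ, ℝ) ∞ L) (v : TB E Q) (w : E × E) :
    mfderiv (IT E) (IC E) (FL L) v w =
      ((w.1, fderiv ℝ (mom L v.proj) (tchart v.proj v) w) : E × (E →L[ℝ] ℝ)) := by
  rw [(hasMFDerivAt_FL hL v).mfderiv]
  rfl

lemma omegaL_apply {L : TB E Q → ℝ} (hL : ContMDiff (IT E) 𝓘(ℝ, ℝ) ∞ L) (v : TB E Q)
    (A B : E × E) :
    omegaL L v A B = fderiv ℝ (mom L v.proj) (tchart v.proj v) B A.1 -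
      fderiv ℝ (mom L v.proj) (tchart v.proj v) A B.1 := by
  have h := extDer_semibasic v (tangent_baseSet v.proj) (fun v => (FL L v).2) (mom L v.proj)
    (by
      rw [extChartAt_tangent]
      exact (contDiffAt_mom hL _ (tchart_self_mem v)).differentiableAt (by simp))
    (by
      intro y hy
      rw [extChartAt_tangent, mom_eq hL v.proj ((mem_tchart_target _ _).2 hy)]
      rfl) A B
  rw [extChartAt_tangent] at h
  unfold omegaL
  rw [← neg_sub, neg_inj]
  exact h

lemma omegaQ_apply (p : CB E Q) (A B : E × (E →L[ℝ] ℝ)) : omegaQ p A B = B.2 A.1 - A.2 B.1 := by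
  have h := extDer_semibasic p (cotangent_baseSet p.proj) (fun p => p.2) Prod.snd
    differentiableAt_snd
    (by
      intro y hy
      rw [extChartAt_cotangent]
      have hy' : y ∈ (cchart p.proj).target := (mem_cchart_target _ _).2 hy
      have h1 := cchart_apply p.proj ((cchart p.proj).symm y)
        ((mem_cchart_source _ _).1 ((cchart p.proj).map_target hy'))
      rw [(cchart p.proj).right_inv hy'] at h1
      exact (congrArg Prod.snd h1).symm) A B
  rw [fderiv_snd] at h
  unfold omegaQ
  rw [← neg_sub, neg_inj]
  exact h

lemma omegaL_eq_omegaQ {L : TB E Q → ℝ} (hL : ContMDiff (IT E) 𝓘(ℝ, ℝ) ∞ L) (v : TB E Q)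
    (A B : TangentSpace (IT E) v) :
    omegaL L v A B = omegaQ (FL L v) (mfderiv (IT E) (IC E) (FL L) v A)
      (mfderiv (IT E) (IC E) (FL L) v B) := by
  rw [omegaL_apply hL v A B, mfderiv_FL hL v A, mfderiv_FL hL v B]
  exact (omegaQ_apply (FL L v) ((A : E × E).1, fderiv ℝ (mom L v.proj) (tchart v.proj v) A)
    ((B : E × E).1, fderiv ℝ (mom L v.proj) (tchart v.proj v) B)).symm

lemma energy_tchart_symm {L : TB E Q → ℝ} (hL : ContMDiff (IT E) 𝓘(ℝ, ℝ) ∞ L) (q : Q) {y : E × E}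
    (hy : y ∈ (tchart q).target) :
    energy L ((tchart q).symm y) = mom L q y y.2 - lag L q y := by
  rw [mom_eq hL q hy]
  have hy1 : y.1 ∈ (extChartAt 𝓘(ℝ, E) q).target := (mem_tchart_target q y).1 hy
  unfold energy lag
  rw [tchart_symm_apply q y hy1]
  rfl

lemma contMDiff_energy {L : TB E Q → ℝ} (hL : ContMDiff (IT E) 𝓘(ℝ, ℝ) ∞ L) :
    ContMDiff (IT E) 𝓘(ℝ, ℝ) ∞ (energy L) := by
  intro v
  have ht := tchart_self_mem v
  have h1 : ContDiffAt ℝ ∞ (fun y : E × E => mom L v.proj y y.2 - lag L v.proj y)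
      (tchart v.proj v) :=
    ((contDiffAt_mom hL _ ht).clm_apply contDiffAt_snd).sub (contDiffAt_lag hL _ ht)
  refine (h1.contMDiffAt.comp v (contMDiffAt_tchart v.proj (mem_chart_source E _))).congr_of_eventuallyEq ?_
  filter_upwards [(isOpen_extChartAt_source (I := IT E) v).mem_nhds
    (mem_extChartAt_source v)] with w hw
  rw [extChartAt_tangent] at hw
  have h3 := energy_tchart_symm hL v.proj ((tchart v.proj).map_source hw)
  rw [(tchart v.proj).left_inv hw] at h3
  exact h3

/-- The derivative of the energy in coordinates, in a vertical direction. -/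
lemma hasFDerivAt_energy {L : TB E Q → ℝ} (hL : ContMDiff (IT E) 𝓘(ℝ, ℝ) ∞ L) (q : Q)
    {y : E × E} (hy : y ∈ (tchart q).target) :
    ∃ e' : E × E →L[ℝ] ℝ, HasFDerivAt (fun y => energy L ((tchart q).symm y)) e' y ∧
      ∀ z : E, e' (0, z) = fderiv ℝ (mom L q) y (0, z) y.2 := by
  have h1 := ((contDiffAt_mom hL q hy).differentiableAt (by simp)).hasFDerivAt.clm_apply
    (hasFDerivAt_snd (𝕜 := ℝ) (p := y))
  have h2 := ((contDiffAt_lag hL q hy).differentiableAt (by simp)).hasFDerivAt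
  refine ⟨_, (h1.sub h2).congr_of_eventuallyEq ?_, ?_⟩
  · filter_upwards [(isOpen_tchart_target q).mem_nhds hy] with y' hy'
    exact energy_tchart_symm hL q hy'
  -- Since $E_L=\langle p,\dot q\rangle-L$ with $p=\partial L/\partial\dot q$, the term $p(z)$
  -- cancels against the fibre derivative of $L$.
  · intro z
    simp [mom]

lemma dTQ_energy_vertical {L : TB E Q → ℝ} (hL : ContMDiff (IT E) 𝓘(ℝ, ℝ) ∞ L) (v : TB E Q)
    (z : E) : dTQ (energy L) v ((0, z) : E × E) =
      fderiv ℝ (mom L v.proj) (tchart v.proj v) ((0, z) : E × E) (v.2 : E) := by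
  obtain ⟨e', h1, h2⟩ := hasFDerivAt_energy hL v.proj (tchart_self_mem v)
  have h3 : HasMFDerivAt (IT E) 𝓘(ℝ, ℝ) (energy L) v e' := by
    refine hasMFDerivAt_of_written (contMDiff_energy hL).continuous.continuousAt
      (by rw [extChartAt_tangent]; exact h1) (Eventually.of_forall fun y => ?_)
    rw [extChartAt_tangent]
    rfl
  rw [dTQ, h3.mfderiv]
  refine (h2 z).trans ?_
  have h4 : (tchart v.proj v).2 = v.2 := congrArg Prod.snd (tchart_self (E := E) v.proj v.2)
  exact congrArg _ h4

/-- The vertical derivative of the momentum is the fibre Hessian of $L$, a second derivative. -/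
lemma fderiv_mom_symm {L : TB E Q → ℝ} (hL : ContMDiff (IT E) 𝓘(ℝ, ℝ) ∞ L) (q : Q) {y : E × E}
    (hy : y ∈ (tchart q).target) (a b : E) :
    fderiv ℝ (mom L q) y (0, a) b = fderiv ℝ (mom L q) y (0, b) a := by
  have h1 := contDiffAt_lag hL q hy
  have h2 : DifferentiableAt ℝ (fderiv ℝ (lag L q)) y :=
    ((h1.fderiv_right (m := 1) (by norm_cast)).differentiableAt one_ne_zero)
  have h3 : fderiv ℝ (mom L q) y =
      (fderiv ℝ (fun y => (fderiv ℝ (lag L q) y).comp (ContinuousLinearMap.inr ℝ E E)) y) := rfl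
  have h4 : IsSymmSndFDerivAt ℝ (lag L q) y :=
    h1.isSymmSndFDerivAt (by rw [minSmoothness_of_isRCLikeNormedField]; exact WithTop.coe_le_coe.2 le_top)
  rw [h3, (h2.hasFDerivAt.clm_comp (hasFDerivAt_const _ _)).fderiv]
  simpa using h4 (0, a) (0, b)

end

/-! ### Fibres of submersions between vector spaces -/

section

section Submersion

variable {W F C : Type*} [NormedAddCommGroup W] [NormedSpace ℝ W] [FiniteDimensional ℝ W]
  [NormedAddCommGroup F] [NormedSpace ℝ F] [FiniteDimensional ℝ F]
  [NormedAddCommGroup C] [NormedSpace ℝ C]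

/-- Near a point where it is a submersion, a smooth map is a linear projection in suitable
coordinates. -/
lemma exists_submersion_coords {g : W → F} {y₀ : W} (hg : ContDiffAt ℝ ∞ g y₀)
    (hs : Function.Surjective (fderiv ℝ g y₀)) :
    ∃ (K : Submodule ℝ W) (κ : W →L[ℝ] K) (Ψ : F × K → W),
      ContDiffAt ℝ ∞ Ψ (g y₀, κ y₀) ∧ Ψ (g y₀, κ y₀) = y₀ ∧
      (∀ᶠ y in 𝓝 y₀, Ψ (g y, κ y) = y) ∧ ∀ᶠ z in 𝓝 (g y₀, κ y₀), g (Ψ z) = z.1 := by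
  set g' := fderiv ℝ g y₀ with hg'
  set K : Submodule ℝ W := LinearMap.ker g'.toLinearMap
  obtain ⟨κ, hκ⟩ : ∃ κ : W →L[ℝ] K, ∀ x : K, κ x = x :=
    Submodule.ClosedComplemented.of_finiteDimensional (𝕜 := ℝ) K
  have hinj : Function.Injective (g'.prod κ) := by
    rw [injective_iff_map_eq_zero]
    intro x hx
    have hx1 : g' x = 0 := congrArg Prod.fst hx
    have hx2 : κ x = 0 := congrArg Prod.snd hx
    have hx3 := hκ ⟨x, hx1⟩
    rw [hx2] at hx3
    exact (congrArg Subtype.val hx3).symm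
  have hsurj : Function.Surjective (g'.prod κ) := by
    rintro ⟨f, k⟩
    obtain ⟨x, rfl⟩ := hs f
    refine ⟨x - κ x + k, ?_⟩
    have h1 : g' (κ x) = 0 := (κ x).2
    have h2 : g' k = 0 := k.2
    simp [h1, h2, hκ]
  set Φ' : W ≃L[ℝ] F × K :=
    (LinearEquiv.ofBijective (g'.prod κ).toLinearMap ⟨hinj, hsurj⟩).toContinuousLinearEquiv
  have hΦ' : (Φ' : W →L[ℝ] F × K) = g'.prod κ := by ext x <;> rfl
  have hΦ : ContDiffAt ℝ ∞ (fun y => (g y, κ y)) y₀ := hg.prodMk κ.contDiff.contDiffAt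
  have hd : HasFDerivAt (fun y => (g y, κ y)) (Φ' : W →L[ℝ] F × K) y₀ := by
    rw [hΦ']
    exact (hg.differentiableAt (by simp)).hasFDerivAt.prodMk κ.hasFDerivAt
  have hst := hΦ.hasStrictFDerivAt' hd (by simp)
  refine ⟨K, κ, hΦ.localInverse hd (by simp), hΦ.to_localInverse hd (by simp),
    hΦ.localInverse_apply_image hd (by simp), hst.eventually_left_inverse, ?_⟩
  filter_upwards [hst.eventually_right_inverse] with z hz
  exact congrArg Prod.fst hz

/-- Parametrize the fibre of `g` by a ball in the kernel `K`. There `Φ` is constant, so its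
derivative kills the fibre directions, hence so does that of `f`. Two maps are kept because `g` is
the submersion while the kernel condition is natural for `Φ`, here the Legendre map. -/
lemma eventually_eq_of_submersion {g : W → F} {y₀ : W} (hg : ContDiffAt ℝ ∞ g y₀)
    (hs : Function.Surjective (fderiv ℝ g y₀)) {Φ : W → C} {f : W → ℝ}
    (hΦ : ∀ᶠ y in 𝓝 y₀, g y = g y₀ → Φ y = Φ y₀)
    (hf : ∀ᶠ y in 𝓝 y₀, ∃ (f' : W →L[ℝ] ℝ) (Φ' : W →L[ℝ] C), HasFDerivAt f f' y ∧
      HasFDerivAt Φ Φ' y ∧ ∀ z, Φ' z = 0 → f' z = 0) :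
    ∀ᶠ y in 𝓝 y₀, g y = g y₀ → f y = f y₀ := by
  obtain ⟨K, κ, Ψ, hΨ, hΨ0, hleft, hright⟩ := exists_submersion_coords hg hs
  set j : K → W := fun k => Ψ (g y₀, k) with hj
  have hι : Tendsto (fun k : K => (g y₀, k)) (𝓝 (κ y₀)) (𝓝 (g y₀, κ y₀)) :=
    (Continuous.prodMk_right _).tendsto _
  have hjt : Tendsto j (𝓝 (κ y₀)) (𝓝 y₀) := by
    have := hΨ.continuousAt.tendsto.comp hι
    rwa [hΨ0] at this
  have hjd : ∀ᶠ k in 𝓝 (κ y₀), DifferentiableAt ℝ j k := by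
    have h1 : ∀ᶠ z in 𝓝 (g y₀, κ y₀), ContDiffAt ℝ 1 Ψ z :=
      (hΨ.of_le (by exact_mod_cast le_top)).eventually (by simp)
    filter_upwards [hι.eventually h1] with k hk
    exact (hk.differentiableAt one_ne_zero).comp k
      (hasFDerivAt_prodMk_right (g y₀) k).differentiableAt
  have hjΦ : ∀ᶠ k in 𝓝 (κ y₀), Φ (j k) = Φ y₀ := by
    filter_upwards [hjt.eventually hΦ, hι.eventually hright] with k h1 h2
    exact h1 h2
  have hconst : ∀ᶠ k in 𝓝 (κ y₀), f (j k) = f (j (κ y₀)) := by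
    have h0 : ∀ᶠ k in 𝓝 (κ y₀), HasFDerivAt (f ∘ j) (0 : K →L[ℝ] ℝ) k := by
      filter_upwards [hjd, hjΦ.eventually_nhds, hjt.eventually hf] with k h1 h2 h3
      obtain ⟨f', Φ', hf', hΦ', hker⟩ := h3
      have h4 : HasFDerivAt (Φ ∘ j) (0 : K →L[ℝ] C) k :=
        (hasFDerivAt_const (Φ y₀) k).congr_of_eventuallyEq h2
      have h5 := h4.unique (hΦ'.comp k h1.hasFDerivAt)
      have h6 := hf'.comp k h1.hasFDerivAt
      have h7 : f'.comp (fderiv ℝ j k) = 0 :=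
        ContinuousLinearMap.ext fun z => hker _ (DFunLike.congr_fun h5 z).symm
      rwa [h7] at h6
    obtain ⟨ε, hε, hball⟩ := Metric.eventually_nhds_iff_ball.1 h0
    filter_upwards [Metric.ball_mem_nhds _ hε] with k hk
    exact (convex_ball (κ y₀) ε).is_const_of_fderivWithin_eq_zero (𝕜 := ℝ) (f := f ∘ j)
      (fun z hz => (hball z hz).differentiableAt.differentiableWithinAt)
      (fun z hz => (hball z hz).hasFDerivWithinAt.fderivWithin
        (Metric.isOpen_ball.uniqueDiffWithinAt hz)) hk (Metric.mem_ball_self hε)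
  have hjy : j (κ y₀) = y₀ := hΨ0
  filter_upwards [hleft, κ.continuous.continuousAt.eventually hconst] with y h1 h2 h3
  rw [h3] at h1
  rw [hjy] at h2
  rw [← h2, hj]
  simp only [h1]

/-- A vector field tangent to a fibre of a submersion is almost tangent to the nearby fibres. -/
lemma exists_bound_of_tangent_fibre {g : W → F} {y₀ : W} (hg : ContDiffAt ℝ ∞ g y₀)
    (hs : Function.Surjective (fderiv ℝ g y₀)) {ρ : W → W} (hρ : ContDiff ℝ ∞ ρ)
    (h : ∀ᶠ y in 𝓝 y₀, g y = g y₀ → fderiv ℝ g y (ρ y) = 0) :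
    ∃ K : ℝ, ∀ᶠ y in 𝓝 y₀, ‖fderiv ℝ g y (ρ y)‖ ≤ K * ‖g y - g y₀‖ := by
  obtain ⟨K, κ, Ψ, hΨ, hΨ0, hleft, hright⟩ := exists_submersion_coords hg hs
  set R : W → F := fun y => fderiv ℝ g y (ρ y)
  have hR : ContDiffAt ℝ 1 R y₀ :=
    (hg.fderiv_right (m := 1) (by norm_cast)).clm_apply (hρ.of_le (by exact_mod_cast le_top)).contDiffAt
  have hRΨ : ContDiffAt ℝ 1 (R ∘ Ψ) (g y₀, κ y₀) :=
    ContDiffAt.comp _ (by rwa [hΨ0]) (hΨ.of_le (by exact_mod_cast le_top))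
  obtain ⟨c, t, ht, hlip⟩ := hRΨ.exists_lipschitzOnWith
  refine ⟨c, ?_⟩
  have hgκ : Tendsto (fun y => (g y, κ y)) (𝓝 y₀) (𝓝 (g y₀, κ y₀)) :=
    (hg.continuousAt.prodMk κ.continuous.continuousAt).tendsto
  have hgκ' : Tendsto (fun y => (g y₀, κ y)) (𝓝 y₀) (𝓝 (g y₀, κ y₀)) :=
    (continuousAt_const.prodMk κ.continuous.continuousAt).tendsto
  have hΨt : Tendsto Ψ (𝓝 (g y₀, κ y₀)) (𝓝 y₀) := by
    have := hΨ.continuousAt.tendsto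
    rwa [hΨ0] at this
  filter_upwards [hleft, hgκ.eventually ht, hgκ'.eventually ht, hgκ'.eventually hright,
    (hΨt.comp hgκ').eventually h] with y h1 h2 h3 h4 h5
  -- Compare `y` with the point of the central fibre that has the same `K`-coordinate: there `R`
  -- vanishes, and the two points differ only by `g y - g y₀` in the straightening coordinates.
  have h6 := hlip.norm_sub_le h2 h3
  have h7 : R (Ψ (g y₀, κ y)) = 0 := h5 h4
  simp only [Function.comp_apply, h1, h7, sub_zero] at h6
  refine h6.trans (le_of_eq ?_)
  simp [Prod.norm_def]

/-- The line is an unparametrized integral curve of `ρ`. The previous bound makes the derivative of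
`g - g y₀` along it at most a multiple of its norm, so Grönwall's inequality forces it to stay zero.
-/
lemma eventually_eq_along_line {g : W → F} {y₀ d : W} (hg : ContDiffAt ℝ ∞ g y₀)
    (hs : Function.Surjective (fderiv ℝ g y₀)) {ρ : W → W} (hρ : ContDiff ℝ ∞ ρ)
    (hρd : ∀ t : ℝ, ρ (y₀ + t • d) = (1 - t) • d)
    (h : ∀ᶠ y in 𝓝 y₀, g y = g y₀ → fderiv ℝ g y (ρ y) = 0) :
    ∃ δ > 0, ∀ t ∈ Icc (0 : ℝ) δ, g (y₀ + t • d) = g y₀ := by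
  obtain ⟨K, hK⟩ := exists_bound_of_tangent_fibre hg hs hρ h
  have hK' : ∃ K' ≥ 0, ∀ᶠ y in 𝓝 y₀, ‖fderiv ℝ g y (ρ y)‖ ≤ K' * ‖g y - g y₀‖ := by
    refine ⟨|K|, abs_nonneg _, hK.mono fun y hy => hy.trans ?_⟩
    gcongr
    exact le_abs_self K
  obtain ⟨K', hK0, hK'⟩ := hK'
  have hd : ∀ᶠ y in 𝓝 y₀, DifferentiableAt ℝ g y :=
    ((hg.of_le (by exact_mod_cast le_top : (1 : ℕ∞ω) ≤ ∞)).eventually (by simp)).mono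
      fun y hy => hy.differentiableAt one_ne_zero
  have hc : Tendsto (fun t : ℝ => y₀ + t • d) (𝓝 0) (𝓝 y₀) := by
    have : Continuous (fun t : ℝ => y₀ + t • d) := by fun_prop
    simpa using this.tendsto 0
  obtain ⟨ε, hε, hball⟩ := Metric.eventually_nhds_iff_ball.1 (hc.eventually (hK'.and hd))
  -- The cap `1 / 2` keeps `1 - t ≥ 1 / 2`, so passing from `ρ` to `d` costs only the factor 2 in
  -- the Grönwall constant `2 * K'`.
  set δ := min (ε / 2) (1 / 2) with hδ
  have hδ0 : 0 < δ := by positivity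
  have hmem : ∀ t ∈ Icc (0 : ℝ) δ, t ∈ Metric.ball (0 : ℝ) ε := by
    intro t ht
    have h1 : t ≤ ε / 2 := ht.2.trans (min_le_left _ _)
    rw [Metric.mem_ball, Real.dist_eq, sub_zero, abs_of_nonneg ht.1]
    linarith
  have hderiv : ∀ t ∈ Icc (0 : ℝ) δ, HasDerivAt (fun t : ℝ => g (y₀ + t • d) - g y₀)
      (fderiv ℝ g (y₀ + t • d) d) t := by
    intro t ht
    have h1 : HasDerivAt (fun t : ℝ => y₀ + t • d) d t := by
      simpa using ((hasDerivAt_id t).smul_const d).const_add y₀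
    exact ((hball t (hmem t ht)).2.hasFDerivAt.comp_hasDerivAt t h1).sub_const _
  refine ⟨δ, hδ0, fun t ht => ?_⟩
  have key := eq_zero_of_abs_deriv_le_mul_abs_self_of_eq_zero_right
    (f := fun t : ℝ => g (y₀ + t • d) - g y₀) (f' := fun t => fderiv ℝ g (y₀ + t • d) d)
    (a := 0) (b := δ) (K := 2 * K')
    (fun s hs => (hderiv s hs).continuousAt.continuousWithinAt)
    (fun s hs => (hderiv s (Ico_subset_Icc_self hs)).hasDerivWithinAt) (by simp) ?_ t ht
  · exact sub_eq_zero.1 key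
  · intro s hs
    have hs' := Ico_subset_Icc_self hs
    have h1 := (hball s (hmem s hs')).1
    have h2 : s ≤ 1 / 2 := hs'.2.trans (min_le_right _ _)
    rw [hρd, map_smul, norm_smul, Real.norm_eq_abs, abs_of_nonneg (by linarith)] at h1
    have h3 := norm_nonneg (fderiv ℝ g (y₀ + s • d) d)
    nlinarith

end Submersion

end

/-! ### Tangent vectors as velocities of curves -/

section

section TangentVectors
variable {V : Type*} [NormedAddCommGroup V] [NormedSpace ℝ V]
  {H : Type*} [TopologicalSpace H] {I : ModelWithCorners ℝ V H}
  {N : Type*} [TopologicalSpace N] [ChartedSpace H N]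
  {V' : Type*} [NormedAddCommGroup V'] [NormedSpace ℝ V']
  {H' : Type*} [TopologicalSpace H'] {I' : ModelWithCorners ℝ V' H'}
  {N' : Type*} [TopologicalSpace N'] [ChartedSpace H' N']

lemma tangentMap_comp_curve {c : ℝ → N} {p : N} {Y : TangentSpace I p} {S : Set N}
    (hc : ContMDiffAt 𝓘(ℝ, ℝ) I ∞ c 0)
    (h : tangentMap 𝓘(ℝ, ℝ) I c ⟨0, (1 : ℝ)⟩ = ⟨p, Y⟩) (hS : ∀ᶠ t in 𝓝 (0 : ℝ), c t ∈ S)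
    {f : N → N'} {f' : TangentSpace I p →L[ℝ] TangentSpace I' (f p)}
    (hf : HasMFDerivWithinAt I I' f S p f') :
    tangentMap 𝓘(ℝ, ℝ) I' (f ∘ c) ⟨0, (1 : ℝ)⟩ = ⟨f p, f' Y⟩ := by
  have hp : c 0 = p := congrArg TotalSpace.proj h
  subst hp
  have hY : mfderiv 𝓘(ℝ, ℝ) I c 0 (1 : ℝ) = Y := eq_of_heq (TotalSpace.mk.inj h).2
  have h1 : HasMFDerivWithinAt 𝓘(ℝ, ℝ) I c (c ⁻¹' S) 0 (mfderiv 𝓘(ℝ, ℝ) I c 0) :=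
    (hc.mdifferentiableAt (by simp)).hasMFDerivAt.hasMFDerivWithinAt
  have h2 := (HasMFDerivWithinAt.comp 0 hf h1 Subset.rfl).hasMFDerivAt hS
  have h3 : mfderiv 𝓘(ℝ, ℝ) I' (f ∘ c) 0 (1 : ℝ) = f' Y := by
    rw [h2.mfderiv, ← hY]
    rfl
  exact congrArg (TotalSpace.mk (f (c 0))) h3

/-- Derivatives within a submanifold are not unique as linear maps, but a curve in `S` with velocity
`Y` determines their value on `Y`. This replaces unique differentiability throughout. -/
lemma tangentTo_hasMFDerivWithinAt_unique {S : Set N} {p : N} {Y : TangentSpace I p}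
    (hY : Y ∈ tangentTo I S p) {f : N → N'} {f₁ f₂ : TangentSpace I p →L[ℝ] TangentSpace I' (f p)}
    (h₁ : HasMFDerivWithinAt I I' f S p f₁) (h₂ : HasMFDerivWithinAt I I' f S p f₂) :
    f₁ Y = f₂ Y := by
  obtain ⟨c, hS, hc, h⟩ := hY
  have := (tangentMap_comp_curve hc h hS h₁).symm.trans (tangentMap_comp_curve hc h hS h₂)
  exact eq_of_heq (TotalSpace.mk.inj this).2

lemma mapsTo_tangentTo {S : Set N} {S' : Set N'} {p : N} {Y : TangentSpace I p}
    (hY : Y ∈ tangentTo I S p) {f : N → N'} (hf : ContMDiffWithinAt I I' ∞ f S p)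
    (hSS' : ∀ᶠ x in 𝓝[S] p, f x ∈ S')
    {f' : TangentSpace I p →L[ℝ] TangentSpace I' (f p)} (hf' : HasMFDerivWithinAt I I' f S p f') :
    f' Y ∈ tangentTo I' S' (f p) := by
  obtain ⟨c, hS, hc, h⟩ := hY
  have hp : c 0 = p := congrArg TotalSpace.proj h
  refine ⟨f ∘ c, ?_, ?_, tangentMap_comp_curve hc h hS hf'⟩
  · have h1 : Tendsto c (𝓝 0) (𝓝[S] p) :=
      tendsto_nhdsWithin_iff.2 ⟨hp ▸ hc.continuousAt.tendsto, hS⟩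
    exact h1.eventually hSS'
  · have h1 : ContMDiffWithinAt 𝓘(ℝ, ℝ) I' ∞ (f ∘ c) (c ⁻¹' S) 0 := by
      subst hp
      exact ContMDiffWithinAt.comp 0 hf hc.contMDiffWithinAt Subset.rfl
    exact h1.contMDiffAt hS

lemma exists_tangentTo_of_curve {S : Set N} {p : N} {c : ℝ → N} (hp : c 0 = p)
    (hS : ∀ᶠ t in 𝓝 (0 : ℝ), c t ∈ S) (hc : ContMDiffAt 𝓘(ℝ, ℝ) I ∞ c 0) :
    ∃ Y ∈ tangentTo I S p, tangentMap 𝓘(ℝ, ℝ) I c ⟨0, (1 : ℝ)⟩ = ⟨p, Y⟩ := by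
  subst hp
  exact ⟨mfderiv 𝓘(ℝ, ℝ) I c 0 (1 : ℝ), ⟨c, hS, hc, rfl⟩, rfl⟩

/-- Every tangent vector of a manifold without boundary is the velocity of a smooth curve. -/
lemma mem_tangentTo_univ [IsManifold I ∞ N] (hI : range I = univ) (p : N) (Y : TangentSpace I p) :
    Y ∈ tangentTo I univ p := by
  have hm : IsManifold I 1 N := IsManifold.of_le (n := ∞) (by exact_mod_cast le_top)
  set y₀ := extChartAt I p p
  have hsymm : ContMDiffAt 𝓘(ℝ, V) I ∞ (extChartAt I p).symm y₀ := by
    have := contMDiffWithinAt_extChartAt_symm_range (I := I) (n := ∞) p (mem_extChartAt_target p)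
    rwa [hI, contMDiffWithinAt_univ] at this
  have hd : HasMFDerivAt 𝓘(ℝ, V) I (extChartAt I p).symm y₀
      (mfderiv 𝓘(ℝ, V) I (extChartAt I p).symm y₀) :=
    (hsymm.mdifferentiableAt (by simp)).hasMFDerivAt
  have hmd : mfderiv 𝓘(ℝ, V) I (extChartAt I p).symm y₀ = ContinuousLinearMap.id ℝ V := by
    rw [← mfderivWithin_univ, ← hI]
    exact mfderivWithin_range_extChartAt_symm
  obtain ⟨y, hy⟩ : ∃ y : V, y = Y := ⟨Y, rfl⟩
  have hl : ContDiff ℝ ∞ (fun t : ℝ => y₀ + t • y) := by fun_prop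
  have hl' : HasMFDerivAt 𝓘(ℝ, ℝ) 𝓘(ℝ, V) (fun t : ℝ => y₀ + t • y) 0
      (ContinuousLinearMap.toSpanSingleton ℝ y) := by
    have : HasDerivAt (fun t : ℝ => y₀ + t • y) y 0 := by
      simpa using ((hasDerivAt_id (0 : ℝ)).smul_const y).const_add y₀
    exact this.hasFDerivAt.hasMFDerivAt
  have h0 : y₀ + (0 : ℝ) • y = y₀ := by simp
  refine ⟨(extChartAt I p).symm ∘ fun t : ℝ => y₀ + t • y, by simp, ?_, ?_⟩
  · refine ContMDiffAt.comp (0 : ℝ) ?_ hl.contMDiff.contMDiffAt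
    rwa [h0]
  · have h1 : tangentMap 𝓘(ℝ, ℝ) 𝓘(ℝ, V) (fun t : ℝ => y₀ + t • y) ⟨0, (1 : ℝ)⟩ =
        (⟨y₀, y⟩ : TangentBundle 𝓘(ℝ, V) V) := by
      have h2 : mfderiv 𝓘(ℝ, ℝ) 𝓘(ℝ, V) (fun t : ℝ => y₀ + t • y) 0 (1 : ℝ) = y := by
        rw [hl'.mfderiv]
        exact one_smul ℝ y
      have h3 : ∀ z : V, z = y₀ → (⟨z, y⟩ : TangentBundle 𝓘(ℝ, V) V) = ⟨y₀, y⟩ := by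
        rintro _ rfl; rfl
      refine Eq.trans ?_ (h3 _ h0)
      exact congrArg (TotalSpace.mk (y₀ + (0 : ℝ) • y)) h2
    rw [tangentMap_comp_curve (S := univ) hl.contMDiff.contMDiffAt h1 (by simp)
      hd.hasMFDerivWithinAt]
    have h4 : ∀ (q : N) (Z : V), q = p → Z = Y →
        (⟨q, Z⟩ : TangentBundle I N) = ⟨p, Y⟩ := by
      rintro _ _ rfl rfl; rfl
    exact h4 _ _ (extChartAt_to_inv p) (by rw [hmd]; exact hy)

end TangentVectors

end

/-! ### Local factorization of the Legendre map through a submersion -/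

section

variable {E : Type*} [NormedAddCommGroup E] [NormedSpace ℝ E] [FiniteDimensional ℝ E]
  {Q : Type*} [TopologicalSpace Q] [ChartedSpace E Q] [IsManifold 𝓘(ℝ, E) ∞ Q]

lemma range_IC : range (IC E) = univ := by simp

/-- The Legendre map in coordinates. -/
def legendre (L : TB E Q → ℝ) (q : Q) (y : E × E) : E × (E →L[ℝ] ℝ) := (y.1, mom L q y)

lemma contDiffAt_legendre {L : TB E Q → ℝ} (hL : ContMDiff (IT E) 𝓘(ℝ, ℝ) ∞ L) (q : Q) {y : E × E}
    (hy : y ∈ (tchart q).target) : ContDiffAt ℝ ∞ (legendre L q) y :=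
  contDiffAt_fst.prodMk (contDiffAt_mom hL q hy)

lemma fderiv_legendre {L : TB E Q → ℝ} (hL : ContMDiff (IT E) 𝓘(ℝ, ℝ) ∞ L) (q : Q) {y : E × E}
    (hy : y ∈ (tchart q).target) (z : E × E) :
    fderiv ℝ (legendre L q) y z = (z.1, fderiv ℝ (mom L q) y z) := by
  have := hasFDerivAt_fst.prodMk
      ((contDiffAt_mom hL q hy).differentiableAt (by simp)).hasFDerivAt
  have h : fderiv ℝ (legendre L q) y = _ := this.fderiv
  rw [h]
  rfl

/-- Near each point of `TQ` the Legendre map factors, in coordinates, through a submersion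
`lam ∘ legendre` onto a vector space, and `lam` is injective on the primary constraint set. -/
lemma exists_local_factorization {L : TB E Q → ℝ} (hL : ContMDiff (IT E) 𝓘(ℝ, ℝ) ∞ L)
    (hreg : AlmostRegular L) (v : TB E Q) :
    ∃ (F : Submodule ℝ (E × (E →L[ℝ] ℝ))) (lam : E × (E →L[ℝ] ℝ) → F)
      (χ : F → E × (E →L[ℝ] ℝ)),
      ContDiffAt ℝ ∞ lam (legendre L v.proj (tchart v.proj v)) ∧
      (∀ᶠ c in 𝓝 (legendre L v.proj (tchart v.proj v)),
        (cchart v.proj).symm c ∈ primary L → χ (lam c) = c) ∧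
      Function.Surjective (fderiv ℝ (fun y => lam (legendre L v.proj y)) (tchart v.proj v)) := by
  set q := v.proj with hq
  set y₀ := tchart q v with hy₀
  set p₀ := FL L v with hp₀
  have hy₀t : y₀ ∈ (tchart q).target := tchart_self_mem v
  have hv : (tchart q).symm y₀ = v :=
    (tchart q).left_inv ((mem_tchart_source _ _).2 (mem_chart_source E _))
  obtain ⟨e, he, hp₀e, F, hF⟩ := hreg.submanifold p₀ ⟨v, rfl⟩
  obtain ⟨P, hP⟩ : ∃ P : (E × (E →L[ℝ] ℝ)) →L[ℝ] F, ∀ x : F, P x = x :=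
    Submodule.ClosedComplemented.of_finiteDimensional (𝕜 := ℝ) F
  have hc₀ : legendre L q y₀ = cchart q p₀ := by
    rw [hp₀, ← hv, cchart_FL hL q hy₀t]
    rfl
  have hp₀s : p₀ ∈ (cchart q).source := (mem_cchart_source _ _).2 (mem_chart_source E _)
  have hc₀t : legendre L q y₀ ∈ (cchart q).target := hc₀ ▸ (cchart q).map_source hp₀s
  have hc₀s : (cchart q).symm (legendre L q y₀) = p₀ := by rw [hc₀, (cchart q).left_inv hp₀s]
  have hsymm := contMDiffAt_cchart_symm q hc₀t
  have hI : ∀ x : E × (E →L[ℝ] ℝ), IC E ((IC E).symm x) = x := fun x =>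
    (IC E).right_inv (by rw [range_IC]; trivial)
  -- `lam` is the chart straightening $M_1$, centred at `p₀` and projected to its model subspace
  -- `F`; on $M_1$ the projection loses nothing, so `χ` recovers the point.
  set lam : E × (E →L[ℝ] ℝ) → F := fun c => P (IC E (e ((cchart q).symm c)) - IC E (e p₀)) with hlam
  set χ : F → E × (E →L[ℝ] ℝ) := fun f => cchart q (e.symm ((IC E).symm (IC E (e p₀) + f)))
  have hlamd : ContDiffAt ℝ ∞ lam (legendre L q y₀) := by
    have h1 : ContMDiffAt (IC E) (IC E) ∞ e ((cchart q).symm (legendre L q y₀)) := by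
      rw [hc₀s]
      exact contMDiffAt_of_mem_maximalAtlas he hp₀e
    have h2 := (((IC E).contMDiff (n := ∞)).contMDiffAt.comp _ (h1.comp _ hsymm)).contDiffAt
    exact P.contDiff.contDiffAt.comp _ (h2.sub contDiffAt_const)
  have hlamp : HasMFDerivAt (IC E) 𝓘(ℝ, F) (fun p => lam (cchart q p)) p₀
      (fderiv ℝ lam (legendre L q y₀)) := by
    have hext : extChartAt (IC E) p₀ = cchart q := extChartAt_cotangent p₀
    refine hasMFDerivAt_of_written (g := lam) ?_ ?_ ?_
    · refine ContinuousAt.comp (g := lam) ?_ (contMDiffAt_cchart q (mem_chart_source E _)).continuousAt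
      rw [← hc₀]
      exact hlamd.continuousAt
    · rw [hext, ← hc₀]
      exact (hlamd.differentiableAt (by simp)).hasFDerivAt
    · rw [hext, ← hc₀]
      filter_upwards [(isOpen_cchart_target q).mem_nhds hc₀t] with c hc
      rw [(cchart q).right_inv hc]
      rfl
  refine ⟨F, lam, χ, hlamd, ?_, ?_⟩
  · have h1 : ∀ᶠ c in 𝓝 (legendre L q y₀), (cchart q).symm c ∈ e.source :=
      hsymm.continuousAt.eventually (e.open_source.mem_nhds (by rwa [hc₀s]))
    filter_upwards [h1, (isOpen_cchart_target q).mem_nhds hc₀t] with c h1 h2 h3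
    have h4 : ((lam c : F) : E × (E →L[ℝ] ℝ)) = IC E (e ((cchart q).symm c)) - IC E (e p₀) :=
      congrArg Subtype.val (hP ⟨_, (hF _ h1).1 h3⟩)
    change cchart q (e.symm ((IC E).symm (IC E (e p₀) + (lam c : E × (E →L[ℝ] ℝ))))) = c
    rw [h4, add_sub_cancel, (IC E).left_inv, e.left_inv h1, (cchart q).right_inv h2]
  · intro f
    -- Surjectivity: a straight line in direction `f` in the straightening chart is a curve in
    -- $M_1$; its velocity lifts to $TQ$ by the submersion hypothesis, and `lam` sends it back to
    -- `f`.
    set c : ℝ → CB E Q := fun t => e.symm ((IC E).symm (IC E (e p₀) + t • (f : E × (E →L[ℝ] ℝ))))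
      with hcdef
    have hc0 : c 0 = p₀ := by
      simp only [hcdef, zero_smul, add_zero, (IC E).left_inv]
      exact e.left_inv hp₀e
    have hline : ContDiff ℝ ∞ (fun t : ℝ => IC E (e p₀) + t • (f : E × (E →L[ℝ] ℝ))) := by fun_prop
    have hI' : ContMDiff 𝓘(ℝ, E × (E →L[ℝ] ℝ)) (IC E) ∞ (IC E).symm := by
      have := (IC E).contMDiffOn_symm (n := ∞)
      rwa [range_IC, contMDiffOn_univ] at this
    have hinner : ContMDiff 𝓘(ℝ, ℝ) (IC E) ∞
        (fun t : ℝ => (IC E).symm (IC E (e p₀) + t • (f : E × (E →L[ℝ] ℝ)))) :=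
      hI'.comp hline.contMDiff
    have hinner0 : (IC E).symm (IC E (e p₀) + (0 : ℝ) • (f : E × (E →L[ℝ] ℝ))) = e p₀ := by
      rw [zero_smul, add_zero, (IC E).left_inv]
    have hcs : ContMDiffAt 𝓘(ℝ, ℝ) (IC E) ∞ c 0 := by
      refine ContMDiffAt.comp (0 : ℝ) ?_ hinner.contMDiffAt
      rw [hinner0]
      exact contMDiffAt_symm_of_mem_maximalAtlas he (e.map_source hp₀e)
    have hct : ∀ᶠ t in 𝓝 (0 : ℝ),
        (IC E).symm (IC E (e p₀) + t • (f : E × (E →L[ℝ] ℝ))) ∈ e.target :=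
      hinner.continuous.continuousAt.eventually
        (e.open_target.mem_nhds (by beta_reduce; rw [hinner0]; exact e.map_source hp₀e))
    have hce : ∀ᶠ t in 𝓝 (0 : ℝ), c t ∈ e.source ∧
        IC E (e (c t)) - IC E (e p₀) = t • (f : E × (E →L[ℝ] ℝ)) := by
      filter_upwards [hct] with t ht
      refine ⟨e.map_target ht, ?_⟩
      rw [hcdef]
      simp only
      rw [e.right_inv ht, hI, add_sub_cancel_left]
    have hcM : ∀ᶠ t in 𝓝 (0 : ℝ), c t ∈ primary L := by
      filter_upwards [hce] with t ht
      rw [hF _ ht.1, ht.2]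
      exact F.smul_mem t f.2
    obtain ⟨Y, hY, hcY⟩ := exists_tangentTo_of_curve hc0 hcM hcs
    obtain ⟨Z, hZ⟩ := hreg.submersion v Y hY
    have hYf : fderiv ℝ lam (legendre L q y₀) Y = f := by
      have h1 := tangentMap_comp_curve hcs hcY (S := univ) (by simp) hlamp.hasMFDerivWithinAt
      have h2 : HasMFDerivAt 𝓘(ℝ, ℝ) 𝓘(ℝ, F) ((fun p => lam (cchart q p)) ∘ c) 0
          (ContinuousLinearMap.toSpanSingleton ℝ f) := by
        have h3 : HasDerivAt (fun t : ℝ => t • f) f 0 := by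
          simpa using (hasDerivAt_id (0 : ℝ)).smul_const f
        refine HasFDerivAt.hasMFDerivAt (h3.hasFDerivAt.congr_of_eventuallyEq ?_)
        have h4 : ∀ᶠ t in 𝓝 (0 : ℝ), c t ∈ (cchart q).source := by
          refine hcs.continuousAt.eventually ?_
          rw [hc0]
          exact (isOpen_extChartAt_source (I := IC E) (⟨q, 0⟩ : CB E Q)).mem_nhds hp₀s
        filter_upwards [hce, h4] with t h5 h6
        simp only [Function.comp_apply, hlam]
        rw [(cchart q).left_inv h6, h5.2, map_smul, hP]
      have h5 : mfderiv 𝓘(ℝ, ℝ) 𝓘(ℝ, F) ((fun p => lam (cchart q p)) ∘ c) 0 (1 : ℝ) = f := by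
        rw [h2.mfderiv]
        exact one_smul ℝ f
      exact (eq_of_heq (TotalSpace.mk.inj h1).2).symm.trans h5
    refine ⟨Z, ?_⟩
    have h6 : HasFDerivAt (fun y => lam (legendre L q y)) _ y₀ :=
      (hlamd.differentiableAt (by simp)).hasFDerivAt.comp y₀
        ((contDiffAt_legendre hL q hy₀t).differentiableAt (by simp)).hasFDerivAt
    rw [h6.fderiv]
    refine Eq.trans ?_ hYf
    refine congrArg (fderiv ℝ lam (legendre L q y₀)) ?_
    refine Eq.trans ?_ hZ
    refine (fderiv_legendre hL q hy₀t Z).trans ?_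
    exact (mfderiv_FL hL v Z).symm

end

/-! ### Fibres of the Legendre map: sections, energy, radial fields -/

section

variable {E : Type*} [NormedAddCommGroup E] [NormedSpace ℝ E] [FiniteDimensional ℝ E]
  {Q : Type*} [TopologicalSpace Q] [ChartedSpace E Q] [IsManifold 𝓘(ℝ, E) ∞ Q]

/-- Legendre images always lie in $M_1$, so `χ` inverts `lam` on them: near `v`, the Legendre map
and the submersion `lam ∘ legendre` have the same level sets. -/
lemma exists_legendre_factorization {L : TB E Q → ℝ} (hL : ContMDiff (IT E) 𝓘(ℝ, ℝ) ∞ L)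
    (hreg : AlmostRegular L) (v : TB E Q) :
    ∃ (F : Submodule ℝ (E × (E →L[ℝ] ℝ))) (lam : E × (E →L[ℝ] ℝ) → F)
      (χ : F → E × (E →L[ℝ] ℝ)),
      ContDiffAt ℝ ∞ lam (legendre L v.proj (tchart v.proj v)) ∧
      (∀ᶠ c in 𝓝 (legendre L v.proj (tchart v.proj v)),
        (cchart v.proj).symm c ∈ primary L → χ (lam c) = c) ∧
      Function.Surjective (fderiv ℝ (fun y => lam (legendre L v.proj y)) (tchart v.proj v)) ∧
      ContDiffAt ℝ ∞ (fun y => lam (legendre L v.proj y)) (tchart v.proj v) ∧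
      ∀ᶠ y in 𝓝 (tchart v.proj v), χ (lam (legendre L v.proj y)) = legendre L v.proj y := by
  obtain ⟨F, lam, χ, h1, h2, h3⟩ := exists_local_factorization hL hreg v
  have hd := contDiffAt_legendre hL v.proj (tchart_self_mem v)
  refine ⟨F, lam, χ, h1, h2, h3, h1.comp _ hd, ?_⟩
  filter_upwards [hd.continuousAt.eventually h2,
    (isOpen_tchart_target v.proj).mem_nhds (tchart_self_mem v)] with y hy hyt
  exact hy ⟨_, FL_tchart_symm hL v.proj hyt⟩

lemma tchart_left_inv (v : TB E Q) : (tchart v.proj).symm (tchart v.proj v) = v :=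
  (tchart v.proj).left_inv ((mem_tchart_source _ _).2 (mem_chart_source E _))

lemma legendre_tchart {L : TB E Q → ℝ} (hL : ContMDiff (IT E) 𝓘(ℝ, ℝ) ∞ L) {q : Q} {v : TB E Q}
    (hv : v ∈ (tchart q).source) : legendre L q (tchart q v) = cchart q (FL L v) := by
  have := cchart_FL hL q ((tchart q).map_source hv)
  rw [(tchart q).left_inv hv] at this
  exact this.symm

/-- The Legendre map has smooth local sections over the primary constraint set. -/
lemma exists_local_section {L : TB E Q → ℝ} (hL : ContMDiff (IT E) 𝓘(ℝ, ℝ) ∞ L)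
    (hreg : AlmostRegular L) (v : TB E Q) :
    ∃ σ : CB E Q → TB E Q, σ (FL L v) = v ∧ ContMDiffAt (IC E) (IT E) ∞ σ (FL L v) ∧
      ∀ᶠ p in 𝓝[primary L] (FL L v), FL L (σ p) = p := by
  obtain ⟨F, lam, χ, hlam, hχ, hs, hg, hχg⟩ := exists_legendre_factorization hL hreg v
  obtain ⟨K, κ, Ψ, hΨ, hΨ0, -, hright⟩ := exists_submersion_coords hg hs
  set q := v.proj
  set y₀ := tchart q v
  have hy₀t : y₀ ∈ (tchart q).target := tchart_self_mem v
  have hc₀ : cchart q (FL L v) = legendre L q y₀ :=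
    (legendre_tchart hL ((mem_tchart_source _ _).2 (mem_chart_source E _))).symm
  have hcc : ContMDiffAt (IC E) 𝓘(ℝ, E × (E →L[ℝ] ℝ)) ∞ (cchart q) (FL L v) :=
    contMDiffAt_cchart q (mem_chart_source E q)
  -- Freezing the kernel coordinate at its value for `v` picks one preimage per point and makes the
  -- section pass through `v`.
  set τ : CB E Q → F × K := fun p => (lam (cchart q p), κ y₀)
  have hτ0 : τ (FL L v) = (lam (legendre L q y₀), κ y₀) := by simp only [τ, hc₀]
  have hτ : ContMDiffAt (IC E) 𝓘(ℝ, F × K) ∞ τ (FL L v) := by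
    have h1 : ContDiffAt ℝ ∞ (fun c => (lam c, κ y₀)) (cchart q (FL L v)) := by
      rw [hc₀]
      exact hlam.prodMk contDiffAt_const
    exact h1.contMDiffAt.comp _ hcc
  have hΨτ : ContMDiffAt (IC E) 𝓘(ℝ, E × E) ∞ (fun p => Ψ (τ p)) (FL L v) := by
    refine ContMDiffAt.comp (FL L v) (g := Ψ) ?_ hτ
    rw [hτ0]
    exact hΨ.contMDiffAt
  have hΨτ0 : Ψ (τ (FL L v)) = y₀ := by rw [hτ0, hΨ0]
  refine ⟨fun p => (tchart q).symm (Ψ (τ p)), ?_, ?_, ?_⟩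
  · simp only [hΨτ0]
    exact tchart_left_inv v
  · refine ContMDiffAt.comp (FL L v) (g := (tchart q).symm) ?_ hΨτ
    rw [hΨτ0]
    exact contMDiffAt_tchart_symm q hy₀t
  · have hτt : Tendsto τ (𝓝 (FL L v)) (𝓝 (lam (legendre L q y₀), κ y₀)) := by
      rw [← hτ0]
      exact hτ.continuousAt
    have hΨτt : Tendsto (fun p => Ψ (τ p)) (𝓝 (FL L v)) (𝓝 y₀) := by
      have := hΨτ.continuousAt.tendsto
      rwa [hΨτ0] at this
    have hcct : Tendsto (cchart q) (𝓝 (FL L v)) (𝓝 (legendre L q y₀)) := by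
      rw [← hc₀]
      exact hcc.continuousAt
    have hps : ∀ᶠ p in 𝓝 (FL L v), p ∈ (cchart q).source :=
      (isOpen_extChartAt_source (I := IC E) (⟨q, 0⟩ : CB E Q)).mem_nhds
        ((mem_cchart_source _ _).2 (mem_chart_source E q))
    filter_upwards [self_mem_nhdsWithin, nhdsWithin_le_nhds hps,
      nhdsWithin_le_nhds (hτt.eventually hright), nhdsWithin_le_nhds (hΨτt.eventually hχg),
      nhdsWithin_le_nhds (hcct.eventually hχ),
      nhdsWithin_le_nhds (hΨτt.eventually ((isOpen_tchart_target q).mem_nhds hy₀t))]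
      with p h1 h2 h3 h4 h5 h6
    have h7 : FL L ((tchart q).symm (Ψ (τ p))) = (cchart q).symm (legendre L q (Ψ (τ p))) :=
      FL_tchart_symm hL q h6
    rw [h7, ← h4, h3]
    simp only [τ]
    rw [h5, (cchart q).left_inv h2]
    rwa [(cchart q).left_inv h2]

/-- A vector in $\ker TFL$ is vertical, $(0,z)$ with $D_{(0,z)}p=0$, and
$dE_L(0,z)=(D_{(0,z)}p)(\dot q)$, so $dE_L$ vanishes on it. -/
lemma energy_locally_const_on_fibre {L : TB E Q → ℝ} (hL : ContMDiff (IT E) 𝓘(ℝ, ℝ) ∞ L)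
    (hreg : AlmostRegular L) (v : TB E Q) :
    ∀ᶠ w in 𝓝 v, FL L w = FL L v → energy L w = energy L v := by
  obtain ⟨F, lam, χ, -, -, hs, hg, hχg⟩ := exists_legendre_factorization hL hreg v
  set q := v.proj
  set y₀ := tchart q v
  have hy₀t : y₀ ∈ (tchart q).target := tchart_self_mem v
  have hvs : v ∈ (tchart q).source := (mem_tchart_source _ _).2 (mem_chart_source E q)
  have key := eventually_eq_of_submersion hg hs (Φ := legendre L q)
    (f := fun y => energy L ((tchart q).symm y))
    (by
      filter_upwards [hχg] with y h1 h2
      rw [← h1, ← hχg.self_of_nhds, h2])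
    (by
      filter_upwards [(isOpen_tchart_target q).mem_nhds hy₀t] with y hy
      obtain ⟨e', h1, h2⟩ := hasFDerivAt_energy hL q hy
      refine ⟨e', fderiv ℝ (legendre L q) y, h1,
        ((contDiffAt_legendre hL q hy).differentiableAt (by simp)).hasFDerivAt, ?_⟩
      rintro ⟨z₁, z₂⟩ hz
      rw [fderiv_legendre hL q hy, Prod.mk_eq_zero] at hz
      obtain ⟨rfl, hz⟩ := hz
      rw [h2, hz]
      rfl)
  have ht : Tendsto (tchart q) (𝓝 v) (𝓝 y₀) :=
    (contMDiffAt_tchart q (mem_chart_source E q)).continuousAt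
  filter_upwards [ht.eventually key, (isOpen_extChartAt_source (I := IT E)
    (⟨q, 0⟩ : TB E Q)).mem_nhds hvs] with w h1 hw h2
  have h3 : legendre L q (tchart q w) = legendre L q y₀ := by
    rw [legendre_tchart hL hw, h2, ← legendre_tchart hL hvs]
  have h4 := h1 (by rw [h3])
  rw [(tchart q).left_inv hw, (tchart q).left_inv hvs] at h4
  exact h4

lemma energy_eq_of_FL_eq {L : TB E Q → ℝ} (hL : ContMDiff (IT E) 𝓘(ℝ, ℝ) ∞ L)
    (hreg : AlmostRegular L) {v w : TB E Q} (h : FL L v = FL L w) : energy L v = energy L w := by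
  refine (hreg.connected_fibres (FL L w) ⟨w, rfl⟩).isPreconnected.induction₂
    (fun v w => energy L v = energy L w) ?_ ?_ ?_ h rfl
  · intro x hx
    filter_upwards [self_mem_nhdsWithin,
      nhdsWithin_le_nhds (energy_locally_const_on_fibre hL hreg x)] with y hy h1
    exact (h1 (Eq.trans hy (Eq.symm hx))).symm
  · exact fun x y z _ _ _ h1 h2 => h1.trans h2
  · exact fun x y _ _ h => h.symm

lemma hamiltonian₁_FL {L : TB E Q → ℝ} (hL : ContMDiff (IT E) 𝓘(ℝ, ℝ) ∞ L)
    (hreg : AlmostRegular L) (v : TB E Q) : hamiltonian₁ L (FL L v) = energy L v := by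
  have h : ∃ w : TB E Q, FL L w = FL L v := ⟨v, rfl⟩
  rw [hamiltonian₁, dif_pos h]
  exact energy_eq_of_FL_eq hL hreg h.choose_spec

lemma tchart_symm_self (q : Q) (u : E) :
    (tchart q).symm (extChartAt 𝓘(ℝ, E) q q, u) = (⟨q, u⟩ : TB E Q) := by
  rw [← tchart_self]
  exact tchart_left_inv (⟨q, u⟩ : TB E Q)

lemma base_mem_tchart_target (q : Q) (u : E) :
    (extChartAt 𝓘(ℝ, E) q q, u) ∈ (tchart (E := E) q).target :=
  (mem_tchart_target _ _).2 (mem_extChartAt_target q)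

lemma FL_eq_iff_mom_eq {L : TB E Q → ℝ} (hL : ContMDiff (IT E) 𝓘(ℝ, ℝ) ∞ L) (q : Q) (u u' : E) :
    FL L ⟨q, u'⟩ = FL L ⟨q, u⟩ ↔
      mom L q (extChartAt 𝓘(ℝ, E) q q, u') = mom L q (extChartAt 𝓘(ℝ, E) q q, u) := by
  have h2 := FL_tchart_symm hL q (base_mem_tchart_target q u')
  have h3 := FL_tchart_symm hL q (base_mem_tchart_target q u)
  have h4 := cchart_FL hL q (base_mem_tchart_target q u')
  have h5 := cchart_FL hL q (base_mem_tchart_target q u)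
  rw [tchart_symm_self] at h2 h3 h4 h5
  constructor
  · intro h6
    rw [h6, h5] at h4
    exact (congrArg Prod.snd h4).symm
  · intro h6
    rw [h2, h3, h6]

/-- Apply the line lemma to `lam ∘ legendre` and the field $(0,a-u)$. Its zero first component keeps
the base point fixed, and $a-(u+t(a-u))=(1-t)(a-u)$. -/
lemma FL_eq_along_segment_near {L : TB E Q → ℝ} (hL : ContMDiff (IT E) 𝓘(ℝ, ℝ) ∞ L)
    (hreg : AlmostRegular L) (q : Q) (u a : E)
    (h : ∀ u' : E, FL L ⟨q, u'⟩ = FL L ⟨q, u⟩ →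
      fderiv ℝ (mom L q) (extChartAt 𝓘(ℝ, E) q q, u') (0, a - u') = 0) :
    ∃ δ > 0, ∀ t ∈ Icc (0 : ℝ) δ, FL L ⟨q, u + t • (a - u)⟩ = FL L ⟨q, u⟩ := by
  obtain ⟨F, lam, χ, hlam, -, hs, hg, hχg⟩ :=
    exists_legendre_factorization hL hreg (⟨q, u⟩ : TB E Q)
  simp only [] at hlam hs hg hχg
  rw [tchart_self] at hlam hs hg hχg
  set y₀ : E × E := (extChartAt 𝓘(ℝ, E) q q, u)
  have hFL : ∀ u' : E, legendre L q (extChartAt 𝓘(ℝ, E) q q, u') = legendre L q y₀ →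
      FL L ⟨q, u'⟩ = FL L ⟨q, u⟩ := fun u' h1 =>
    (FL_eq_iff_mom_eq hL q u u').2 (congrArg Prod.snd h1)
  have hfib : ∀ᶠ y in 𝓝 y₀, lam (legendre L q y) = lam (legendre L q y₀) →
      legendre L q y = legendre L q y₀ := by
    filter_upwards [hχg] with y h1 h2
    rw [← h1, ← hχg.self_of_nhds, h2]
  obtain ⟨δ, hδ, hline⟩ := eventually_eq_along_line (d := ((0, a - u) : E × E)) hg hs
    (ρ := fun y => (0, a - y.2)) (by fun_prop)
    (by
      intro t
      refine Prod.ext (by simp) ?_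
      simp only [y₀, Prod.snd_add, Prod.smul_snd]
      module)
    (by
      filter_upwards [hfib] with y h1 h2
      have h3 := h1 h2
      obtain ⟨y₁, u'⟩ := y
      obtain rfl : y₁ = extChartAt 𝓘(ℝ, E) q q := congrArg Prod.fst h3
      have h4 := h u' (hFL u' h3)
      have h5 : HasFDerivAt (fun y => lam (legendre L q y)) _ (extChartAt 𝓘(ℝ, E) q q, u') :=
        HasFDerivAt.comp (g := lam) _
          (by rw [h3]; exact (hlam.differentiableAt (by simp)).hasFDerivAt)
          ((contDiffAt_legendre hL q (base_mem_tchart_target q u')).differentiableAt (by simp)).hasFDerivAt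
      rw [h5.fderiv, ContinuousLinearMap.comp_apply, fderiv_legendre hL q (base_mem_tchart_target q u')]
      simp only [h4]
      exact map_zero _)
  have hc : Tendsto (fun t : ℝ => y₀ + t • ((0, a - u) : E × E)) (𝓝 0) (𝓝 y₀) := by
    have : Continuous (fun t : ℝ => y₀ + t • ((0, a - u) : E × E)) := by fun_prop
    simpa using this.tendsto 0
  -- A second shrinking is needed: equality of `lam` values gives equality of Legendre images only
  -- near `y₀`.
  obtain ⟨ε, hε, hball⟩ := Metric.eventually_nhds_iff_ball.1 (hc.eventually hfib)
  refine ⟨min δ (ε / 2), by positivity, fun t ht => hFL _ ?_⟩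
  have h1 := hball t (by
    have := ht.2.trans (min_le_right _ _)
    rw [Metric.mem_ball, Real.dist_eq, sub_zero, abs_of_nonneg ht.1]
    linarith) (hline t ⟨ht.1, ht.2.trans (min_le_left _ _)⟩)
  have h2 : y₀ + t • ((0, a - u) : E × E) = (extChartAt 𝓘(ℝ, E) q q, u + t • (a - u)) :=
    Prod.ext (by simp [y₀]) (by simp [y₀])
  rwa [h2] at h1

/-- If along a fibre of the Legendre map the radial field towards `a` is tangent to the fibre, then
`a` belongs to the fibre. -/
lemma FL_eq_of_radial_tangent {L : TB E Q → ℝ}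
    (hL : ContMDiff (IT E) 𝓘(ℝ, ℝ) ∞ L)
    (hreg : AlmostRegular L) (q : Q) (u a : E)
    (h : ∀ u' : E, FL L ⟨q, u'⟩ = FL L ⟨q, u⟩ →
      fderiv ℝ (mom L q) (extChartAt 𝓘(ℝ, E) q q, u') (0, a - u') = 0) :
    FL L ⟨q, a⟩ = FL L ⟨q, u⟩ := by
  set s : Set ℝ := {t | FL L ⟨q, u + t • (a - u)⟩ = FL L ⟨q, u⟩} with hs
  have hclosed : IsClosed s := by
    have : s = (fun t : ℝ => mom L q (extChartAt 𝓘(ℝ, E) q q, u + t • (a - u))) ⁻¹'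
        {mom L q (extChartAt 𝓘(ℝ, E) q q, u)} := by
      ext t
      exact FL_eq_iff_mom_eq hL q u _
    rw [this]
    refine IsClosed.preimage ?_ isClosed_singleton
    rw [continuous_iff_continuousAt]
    intro t
    refine ContinuousAt.comp (g := mom L q) (contDiffAt_mom hL q (base_mem_tchart_target q _)).continuousAt ?_
    fun_prop
  -- Continuous induction on the segment: the set of good parameters is closed, and the local lemma,
  -- applied afresh at each good point, extends it to the right.
  have hsub : Icc (0 : ℝ) 1 ⊆ s := by
    refine (hclosed.inter isClosed_Icc).Icc_subset_of_forall_exists_gt (by simp [hs]) ?_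
    rintro t ⟨ht, ht0, ht1⟩ t' (ht' : t < t')
    obtain ⟨δ, hδ, hδ'⟩ := FL_eq_along_segment_near hL hreg q (u + t • (a - u)) a
      (fun u' hu' => h u' (hu'.trans ht))
    have h1t : 0 < 1 - t := by linarith
    set r := min δ (t' - t) with hr
    have hr0 : 0 < r := lt_min hδ (by linarith)
    -- Moving a fraction `r` of the remaining way from `u + t • (a - u)` to `a` reaches the
    -- parameter `t + r * (1 - t)` of the original segment.
    refine ⟨t + r * (1 - t), ?_, by nlinarith, ?_⟩
    · have h1 := (hδ' r ⟨hr0.le, min_le_left _ _⟩).trans ht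
      have h2 : u + t • (a - u) + r • (a - (u + t • (a - u))) = u + (t + r * (1 - t)) • (a - u) := by
        module
      rw [h2] at h1
      exact h1
    · have : r ≤ t' - t := min_le_right _ _
      nlinarith
  have := hsub (right_mem_Icc.2 zero_le_one)
  simpa [hs] using this

end

/-! ### Transfer between the Lagrangian and Hamiltonian sides -/

section

section
variable {V : Type*} [NormedAddCommGroup V] [NormedSpace ℝ V]
  {H : Type*} [TopologicalSpace H] {I : ModelWithCorners ℝ V H}
  {N : Type*} [TopologicalSpace N] [ChartedSpace H N]

lemma tangentMap_eq_of_eventuallyEq {c d : ℝ → N} (h : c =ᶠ[𝓝 0] d) :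
    tangentMap 𝓘(ℝ, ℝ) I c ⟨0, (1 : ℝ)⟩ = tangentMap 𝓘(ℝ, ℝ) I d ⟨0, (1 : ℝ)⟩ := by
  have h1 : ∀ (b b' : N) (w w' : V), b = b' → w = w' →
      (⟨b, w⟩ : TangentBundle I N) = ⟨b', w'⟩ := by
    rintro _ _ _ _ rfl rfl; rfl
  exact h1 _ _ _ _ h.self_of_nhds (DFunLike.congr_fun h.mfderiv_eq (1 : ℝ))

end

variable {E : Type*} [NormedAddCommGroup E] [NormedSpace ℝ E] [FiniteDimensional ℝ E]
  {Q : Type*} [TopologicalSpace Q] [ChartedSpace E Q] [IsManifold 𝓘(ℝ, E) ∞ Q]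
  {L : TB E Q → ℝ}

lemma mfderiv_FL_mem_tangentTo (hL : ContMDiff (IT E) 𝓘(ℝ, ℝ) ∞ L) (v : TB E Q) {S : Set (TB E Q)}
    {T : Set (CB E Q)} (hST : MapsTo (FL L) S T) {Z : TangentSpace (IT E) v}
    (hZ : Z ∈ tangentTo (IT E) S v) :
    mfderiv (IT E) (IC E) (FL L) v Z ∈ tangentTo (IC E) T (FL L v) :=
  mapsTo_tangentTo hZ (contMDiff_FL hL).contMDiffAt.contMDiffWithinAt
    (eventually_nhdsWithin_of_forall hST)
    ((contMDiff_FL hL).mdifferentiable (by simp) v).hasMFDerivAt.hasMFDerivWithinAt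

lemma mfderiv_FL_mem_tangentTo_primary (hL : ContMDiff (IT E) 𝓘(ℝ, ℝ) ∞ L) (v : TB E Q)
    (Z : TangentSpace (IT E) v) :
    mfderiv (IT E) (IC E) (FL L) v Z ∈ tangentTo (IC E) (primary L) (FL L v) :=
  mfderiv_FL_mem_tangentTo hL v (S := univ) (fun w _ => mem_range_self w)
    (mem_tangentTo_univ (by simp) v Z)

/-- Tangent vectors of subsets of the primary constraint set can be lifted by the Legendre map. -/
lemma exists_tangentTo_lift (hL : ContMDiff (IT E) 𝓘(ℝ, ℝ) ∞ L) (hreg : AlmostRegular L)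
    {S : Set (CB E Q)} (hS : S ⊆ primary L) (v : TB E Q) {Y : TangentSpace (IC E) (FL L v)}
    (hY : Y ∈ tangentTo (IC E) S (FL L v)) :
    ∃ Z ∈ tangentTo (IT E) (FL L ⁻¹' S) v, mfderiv (IT E) (IC E) (FL L) v Z = Y := by
  obtain ⟨σ, hσv, hσ, hσFL⟩ := exists_local_section hL hreg v
  obtain ⟨c, hcS, hc, hcY⟩ := hY
  have hc0 : c 0 = FL L v := congrArg TotalSpace.proj hcY
  have hct : Tendsto c (𝓝 0) (𝓝[primary L] (FL L v)) :=
    tendsto_nhdsWithin_iff.2 ⟨hc0 ▸ hc.continuousAt.tendsto, hcS.mono fun t ht => hS ht⟩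
  have hev : ∀ᶠ t in 𝓝 (0 : ℝ), FL L (σ (c t)) = c t := hct.eventually hσFL
  have hs : ContMDiffAt 𝓘(ℝ, ℝ) (IT E) ∞ (σ ∘ c) 0 :=
    ContMDiffAt.comp (0 : ℝ) (by rwa [hc0]) hc
  obtain ⟨Z, hZ, hcZ⟩ := exists_tangentTo_of_curve (p := v) (S := FL L ⁻¹' S) (c := σ ∘ c)
    (by rw [Function.comp_apply, hc0, hσv])
    (by
      filter_upwards [hcS, hev] with t h1 h2
      rw [mem_preimage, Function.comp_apply, h2]
      exact h1) hs
  refine ⟨Z, hZ, ?_⟩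
  have h1 := tangentMap_comp_curve hs hcZ (S := univ) (by simp)
    ((contMDiff_FL hL).mdifferentiable (by simp) v).hasMFDerivAt.hasMFDerivWithinAt
  have h2 : tangentMap 𝓘(ℝ, ℝ) (IC E) (FL L ∘ σ ∘ c) ⟨0, (1 : ℝ)⟩ =
      tangentMap 𝓘(ℝ, ℝ) (IC E) c ⟨0, (1 : ℝ)⟩ := tangentMap_eq_of_eventuallyEq hev
  have h3 := h1.symm.trans (h2.trans hcY)
  exact eq_of_heq (TotalSpace.mk.inj h3).2

lemma contMDiffOn_hamiltonian₁ (hL : ContMDiff (IT E) 𝓘(ℝ, ℝ) ∞ L) (hreg : AlmostRegular L) :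
    ContMDiffOn (IC E) 𝓘(ℝ, ℝ) ∞ (hamiltonian₁ L) (primary L) := by
  rintro _ ⟨v, rfl⟩
  obtain ⟨σ, hσv, hσ, hσFL⟩ := exists_local_section hL hreg v
  have h1 : ContMDiffAt (IC E) 𝓘(ℝ, ℝ) ∞ (energy L ∘ σ) (FL L v) :=
    ((contMDiff_energy hL).contMDiffAt).comp _ hσ
  refine h1.contMDiffWithinAt.congr_of_eventuallyEq ?_ ?_
  · filter_upwards [hσFL] with p hp
    rw [Function.comp_apply, ← hamiltonian₁_FL hL hreg, hp]
  · rw [Function.comp_apply, hσv, hamiltonian₁_FL hL hreg]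

lemma mfderivWithin_hamiltonian₁_FL (hL : ContMDiff (IT E) 𝓘(ℝ, ℝ) ∞ L) (hreg : AlmostRegular L)
    (v : TB E Q) (Z : TangentSpace (IT E) v) :
    mfderivWithin (IC E) 𝓘(ℝ, ℝ) (hamiltonian₁ L) (primary L) (FL L v)
      (mfderiv (IT E) (IC E) (FL L) v Z) = dTQ (energy L) v Z := by
  have h1 : HasMFDerivWithinAt (IC E) 𝓘(ℝ, ℝ) (hamiltonian₁ L) (primary L) (FL L v) _ :=
    ((contMDiffOn_hamiltonian₁ hL hreg).mdifferentiableOn (by simp) _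
      ⟨v, rfl⟩).hasMFDerivWithinAt
  have h2 := (HasMFDerivWithinAt.comp v h1
    ((contMDiff_FL hL).mdifferentiable (by simp) v).hasMFDerivAt.hasMFDerivWithinAt
    (s := univ) (fun w _ => ⟨w, rfl⟩)).hasMFDerivAt univ_mem
  have h3 : hamiltonian₁ L ∘ FL L = energy L := funext fun w => hamiltonian₁_FL hL hreg w
  rw [h3] at h2
  rw [dTQ, h2.mfderiv]
  rfl

lemma M_subset_primary (L : TB E Q → ℝ) (l : ℕ) : M L l ⊆ primary L := by
  induction l with
  | zero => exact Subset.rfl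
  | succ l ih => exact fun p hp => ih hp.1

/-- By induction on `l`: $TFL$ maps the vectors tangent to $FL^{-1}(M_l)$ onto those tangent to
$M_l$ (local sections lift curves), and the Lagrangian equation is the pull-back of the Hamiltonian
one. -/
lemma P_eq_preimage_M (hL : ContMDiff (IT E) 𝓘(ℝ, ℝ) ∞ L) (hreg : AlmostRegular L) (l : ℕ) :
    P L l = FL L ⁻¹' M L l := by
  induction l with
  | zero =>
    ext v
    exact ⟨fun _ => ⟨v, rfl⟩, fun _ => trivial⟩
  | succ l ih =>
    have hP : P L (l + 1) = {v ∈ P L l | ∃ Z ∈ tangentTo (IT E) (P L l) v,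
        ∀ Y ∈ tangentTo (IT E) univ v,
          omegaL L v Z Y = mfderivWithin (IT E) 𝓘(ℝ, ℝ) (energy L) univ v Y} := rfl
    have hM : M L (l + 1) = {p ∈ M L l | ∃ Z ∈ tangentTo (IC E) (M L l) p,
        ∀ Y ∈ tangentTo (IC E) (primary L) p,
          omegaQ p Z Y = mfderivWithin (IC E) 𝓘(ℝ, ℝ) (hamiltonian₁ L) (primary L) p Y} := rfl
    rw [hP, hM, ih]
    ext v
    simp only [mem_ofPred_eq, mem_preimage, mfderivWithin_univ]
    refine and_congr_right fun _ => ⟨?_, ?_⟩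
    · rintro ⟨Z, hZ, hZY⟩
      refine ⟨_, mfderiv_FL_mem_tangentTo hL v (mapsTo_preimage _ _) hZ, fun Y hY => ?_⟩
      obtain ⟨Y', -, rfl⟩ := exists_tangentTo_lift hL hreg Subset.rfl v hY
      rw [← omegaL_eq_omegaQ hL, mfderivWithin_hamiltonian₁_FL hL hreg,
        hZY Y' (mem_tangentTo_univ (by simp) v Y')]
      rfl
    · rintro ⟨X, hX, hXY⟩
      obtain ⟨Z, hZ, rfl⟩ := exists_tangentTo_lift hL hreg (M_subset_primary L l) v hX
      refine ⟨Z, hZ, fun Y _ => ?_⟩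
      rw [omegaL_eq_omegaQ hL, hXY _ (mfderiv_FL_mem_tangentTo_primary hL v Y),
        mfderivWithin_hamiltonian₁_FL hL hreg]
      rfl

lemma solvesEL_of_solvesHamilton (hL : ContMDiff (IT E) 𝓘(ℝ, ℝ) ∞ L) (hreg : AlmostRegular L)
    {v : TB E Q} {w : TangentSpace (IT E) v}
    (h : SolvesHamilton L (FL L v) (mfderiv (IT E) (IC E) (FL L) v w)) : SolvesEL L v w := by
  intro Y
  rw [omegaL_eq_omegaQ hL, h _ (mfderiv_FL_mem_tangentTo_primary hL v Y),
    mfderivWithin_hamiltonian₁_FL hL hreg]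

/-- Test Hamilton's equation on the image of a vertical vector $(0,y)$: with $H$ the fibre Hessian
of $L$ at $u$, it says $H(y,X_1)=H(y,u)$. Symmetry of $H$ puts $X_1-u$ in its kernel. -/
lemma fderiv_mom_radial (hL : ContMDiff (IT E) 𝓘(ℝ, ℝ) ∞ L) (hreg : AlmostRegular L) (q : Q)
    (u : E) (X : E × (E →L[ℝ] ℝ)) (h : SolvesHamilton L (FL L ⟨q, u⟩) X) :
    fderiv ℝ (mom L q) (extChartAt 𝓘(ℝ, E) q q, u) (0, X.1 - u) = 0 := by
  ext y
  set v : TB E Q := ⟨q, u⟩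
  rw [fderiv_mom_symm hL q (base_mem_tchart_target q u), map_sub]
  have h1 := (h _ (mfderiv_FL_mem_tangentTo_primary hL v ((0, y) : E × E))).trans
    (mfderivWithin_hamiltonian₁_FL hL hreg v ((0, y) : E × E))
  have h2 := dTQ_energy_vertical hL v y
  have h3 := mfderiv_FL hL v (0, y)
  rw [h3] at h1
  have h4 := omegaQ_apply (FL L v) X ((0, fderiv ℝ (mom L v.proj) (tchart v.proj v) (0, y)) :
    E × (E →L[ℝ] ℝ))
  have h5 : tchart v.proj v = (extChartAt 𝓘(ℝ, E) q q, u) := tchart_self q u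
  rw [h5] at h1 h2 h4
  have h6 := h4.symm.trans (h1.trans h2)
  simp only [map_zero, sub_zero] at h6
  exact sub_eq_zero.2 h6

/-- The SODE condition fixes the base component; the Euler–Lagrange equation tested on $(y,0)$ then
fixes the derivative of the momentum. -/
lemma mfderiv_FL_eq_of_solvesEL (hL : ContMDiff (IT E) 𝓘(ℝ, ℝ) ∞ L) {v : TB E Q} {w w' : E × E}
    (h : SolvesEL L v w) (h' : SolvesEL L v w') (hs : IsSODE v w) (hs' : IsSODE v w') :
    mfderiv (IT E) (IC E) (FL L) v w = mfderiv (IT E) (IC E) (FL L) v w' := by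
  have h1 : w.1 = w'.1 := ((isSODE_iff v w).1 hs).trans ((isSODE_iff v w').1 hs').symm
  rw [mfderiv_FL hL v w, mfderiv_FL hL v w']
  refine Prod.ext h1 (ContinuousLinearMap.ext fun y => ?_)
  have h2 := (h ((y, 0) : E × E)).trans (h' ((y, 0) : E × E)).symm
  rw [omegaL_apply hL v w (y, 0), omegaL_apply hL v w' (y, 0), h1] at h2
  exact sub_right_injective h2

/-- $\tau_Q=\pi_Q\circ FL$ gives $T\tau_Q(\xi(v))=T\pi_Q(X(FL(v)))$, so neither the choice of $v$
nor that of $\xi$ matters, and smoothness of $\beta_\xi$ follows from that of $X$. -/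
lemma beta_apply {Mf : Set (CB E Q)} (hMf : Mf ⊆ primary L)
    (hL : ContMDiff (IT E) 𝓘(ℝ, ℝ) ∞ L)
    {X : ∀ p : CB E Q, TangentSpace (IC E) p} {ξ : ∀ v : TB E Q, TangentSpace (IT E) v}
    (hξ : ∀ v ∈ FL L ⁻¹' Mf, mfderiv (IT E) (IC E) (FL L) v (ξ v) = X (FL L v))
    {p : CB E Q} (hp : p ∈ Mf) :
    beta L (FL L ⁻¹' Mf) ξ p = tangentMap (IC E) 𝓘(ℝ, E) (proj E Q) ⟨p, X p⟩ := by
  have h : ∃ v ∈ FL L ⁻¹' Mf, FL L v = p := by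
    obtain ⟨v, rfl⟩ := hMf hp
    exact ⟨v, hp, rfl⟩
  rw [beta, dif_pos h]
  obtain ⟨h1, h2⟩ := h.choose_spec
  generalize h.choose = v at h1 h2
  subst h2
  have h3 := hξ v h1
  have h4 : mfderiv (IT E) 𝓘(ℝ, E) (tau E Q) v (ξ v) =
      mfderiv (IC E) 𝓘(ℝ, E) (proj E Q) (FL L v) (X (FL L v)) := by
    rw [(hasMFDerivAt_tau v).mfderiv, (hasMFDerivAt_proj (FL L v)).mfderiv, ← h3]
    rw [mfderiv_FL hL v (ξ v)]
    rfl
  exact congrArg (TotalSpace.mk v.proj) h4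

lemma tangentMap_proj_apply (p : CB E Q) (X : E × (E →L[ℝ] ℝ)) :
    tangentMap (IC E) 𝓘(ℝ, E) (proj E Q) ⟨p, X⟩ = (⟨p.proj, X.1⟩ : TB E Q) := by
  have h : mfderiv (IC E) 𝓘(ℝ, E) (proj E Q) p X = X.1 := by
    rw [(hasMFDerivAt_proj p).mfderiv]
    rfl
  exact congrArg (TotalSpace.mk p.proj) h

/-- This is the section property of $\beta_\xi$. The target $T\pi_Q(X(p))$ is the same for every
$u'$ in the fibre over $p$, so the radial relation holds along the whole fibre. -/
lemma FL_tangentMap_proj (hL : ContMDiff (IT E) 𝓘(ℝ, ℝ) ∞ L) (hreg : AlmostRegular L) {p : CB E Q}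
    (hp : p ∈ primary L) (X : ∀ p : CB E Q, TangentSpace (IC E) p)
    (hX : SolvesHamilton L p (X p)) :
    FL L (tangentMap (IC E) 𝓘(ℝ, E) (proj E Q) ⟨p, X p⟩) = p := by
  obtain ⟨⟨q, u⟩, rfl⟩ := hp
  rw [tangentMap_proj_apply (FL L ⟨q, u⟩) (X (FL L ⟨q, u⟩))]
  refine FL_eq_of_radial_tangent hL hreg q u _ fun u' hu' => ?_
  have h1 : ∀ p : CB E Q, p = FL L ⟨q, u⟩ → SolvesHamilton L p (X p) := by
    rintro _ rfl
    exact hX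
  have h2 : ∀ p : CB E Q, p = FL L ⟨q, u⟩ → (X p : E × (E →L[ℝ] ℝ)) = X (FL L ⟨q, u⟩) := by
    rintro _ rfl
    rfl
  have h3 := fderiv_mom_radial hL hreg q u' _ (h1 _ hu')
  rwa [h2 _ hu'] at h3

end

/-! ### The field $X_\xi$ and the Hamilton–Jacobi theorem -/

section

variable {E : Type*} [NormedAddCommGroup E] [NormedSpace ℝ E] [FiniteDimensional ℝ E]
  {Q : Type*} [TopologicalSpace Q] [ChartedSpace E Q] [IsManifold 𝓘(ℝ, E) ∞ Q]
  {L : TB E Q → ℝ}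

lemma contMDiffOn_tangentMap_proj {S : Set (CB E Q)} {X : ∀ p : CB E Q, TangentSpace (IC E) p}
    (hX : IsFieldOn (IC E) S X) :
    ContMDiffOn (IC E) (IT E) ∞
      (fun p => (tangentMap (IC E) 𝓘(ℝ, E) (proj E Q) ⟨p, X p⟩ : TB E Q)) S :=
  (contMDiff_projection.contMDiff_tangentMap (m := ∞) (by norm_cast)).comp_contMDiffOn hX.2

/-- Along a section of the Legendre map that consists of the velocities of a solution `X` of the
Hamilton equations, the image of `X` is the only solution of the Euler-Lagrange equations that is
tangent to the section and satisfies the SODE condition. -/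
lemma sodeField_unique_solution (hL : ContMDiff (IT E) 𝓘(ℝ, ℝ) ∞ L) (hreg : AlmostRegular L)
    {S : Set (CB E Q)} {β : CB E Q → TB E Q} {X : ∀ p : CB E Q, TangentSpace (IC E) p}
    (hβ : ContMDiffOn (IC E) (IT E) ∞ β S) (hsec : ∀ p ∈ S, FL L (β p) = p)
    (hX : ∀ p ∈ S, X p ∈ tangentTo (IC E) S p) (hsol : ∀ p ∈ S, SolvesHamilton L p (X p))
    (hvel : ∀ p ∈ S, β p = ⟨p.proj, (X p : E × (E →L[ℝ] ℝ)).1⟩) {p : CB E Q} (hp : p ∈ S) :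
    ∃ w : TangentSpace (IT E) (β p), sodeField L S β X (β p) = ⟨β p, w⟩ ∧
      w ∈ tangentTo (IT E) (β '' S) (β p) ∧ SolvesEL L (β p) w ∧ IsSODE (β p) w ∧
      ∀ w' ∈ tangentTo (IT E) (β '' S) (β p),
        SolvesEL L (β p) w' → IsSODE (β p) w' → w' = w := by
  have hB : HasMFDerivWithinAt (IC E) (IT E) β S p (mfderivWithin (IC E) (IT E) β S p) :=
    (hβ.mdifferentiableOn (by simp) p hp).hasMFDerivWithinAt
  have hFL : ∀ v : TB E Q, HasMFDerivAt (IT E) (IC E) (FL L) v (mfderiv (IT E) (IC E) (FL L) v) :=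
    fun v => ((contMDiff_FL hL).mdifferentiable (by simp) v).hasMFDerivAt
  set w : TangentSpace (IT E) (β p) := mfderivWithin (IC E) (IT E) β S p (X p) with hw
  have hXe : (X (FL L (β p)) : E × (E →L[ℝ] ℝ)) = X p := by
    have h : ∀ p' : CB E Q, p' = p → (X p' : E × (E →L[ℝ] ℝ)) = X p := by
      rintro _ rfl
      rfl
    exact h _ (hsec p hp)
  -- Differentiate `FL L ∘ β = id` on `S` in the tangent direction `X p`.
  have hFLw : mfderiv (IT E) (IC E) (FL L) (β p) w = X (FL L (β p)) := by
    refine Eq.trans ?_ hXe.symm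
    have h1 : HasMFDerivWithinAt (IC E) (IC E) (FL L ∘ β) S p _ :=
      (hFL (β p)).comp_hasMFDerivWithinAt p hB
    have h2 : HasMFDerivWithinAt (IC E) (IC E) (FL L ∘ β) S p
        (ContinuousLinearMap.id ℝ (E × (E →L[ℝ] ℝ))) :=
      (hasMFDerivWithinAt_id S p).congr_of_eventuallyEq
        (eventually_nhdsWithin_of_forall hsec) (hsec p hp)
    exact tangentTo_hasMFDerivWithinAt_unique (hX p hp) h1 h2
  have hwt : w ∈ tangentTo (IT E) (β '' S) (β p) :=
    mapsTo_tangentTo (hX p hp) (hβ p hp)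
      (eventually_nhdsWithin_of_forall fun x hx => mem_image_of_mem β hx) hB
  have hEL : SolvesEL L (β p) w := by
    refine solvesEL_of_solvesHamilton hL hreg ?_
    rw [hFLw]
    exact hsol _ (by rwa [hsec p hp])
  have hSODE : IsSODE (β p) w := by
    rw [isSODE_iff (β p) w]
    have h1 := (mfderiv_FL hL (β p) w).symm.trans (hFLw.trans hXe)
    have h2 : ((β p).2 : E) = (X p : E × (E →L[ℝ] ℝ)).1 :=
      congrArg (fun v : TB E Q => (v.2 : E)) (hvel p hp)
    exact (congrArg Prod.fst h1).trans h2.symm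
  refine ⟨w, ?_, hwt, hEL, hSODE, fun w' hw't hEL' hSODE' => ?_⟩
  · have h : ∀ p' : CB E Q, p' = p → tangentMapWithin (IC E) (IT E) β S ⟨p', X p'⟩ =
        (⟨β p, w⟩ : TangentBundle (IT E) (TB E Q)) := by
      rintro _ rfl
      rfl
    exact h _ (hsec p hp)
  -- On the image of `β` one has `β ∘ FL L = id`, so tangent vectors of the image are recovered from
  -- their $TFL$-images, and these agree.
  · have h1 := mfderiv_FL_eq_of_solvesEL hL hEL' hEL hSODE' hSODE
    have hp' : FL L (β p) ∈ S := by rwa [hsec p hp]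
    have h2 : HasMFDerivWithinAt (IT E) (IT E) (β ∘ FL L) (β '' S) (β p) _ :=
      HasMFDerivWithinAt.comp (β p)
        (hβ.mdifferentiableOn (by simp) _ hp').hasMFDerivWithinAt (hFL (β p)).hasMFDerivWithinAt
        (by
          rintro _ ⟨x, hx, rfl⟩
          rwa [mem_preimage, hsec x hx])
    have h3 : ∀ v ∈ β '' S, (β ∘ FL L) v = v := by
      rintro _ ⟨x, hx, rfl⟩
      rw [Function.comp_apply, hsec x hx]
    have h4 : HasMFDerivWithinAt (IT E) (IT E) (β ∘ FL L) (β '' S) (β p)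
        (ContinuousLinearMap.id ℝ (E × E)) :=
      (hasMFDerivWithinAt_id (β '' S) (β p)).congr_of_eventuallyEq
        (eventually_nhdsWithin_of_forall h3) (h3 _ (mem_image_of_mem β hp))
    have h5 := tangentTo_hasMFDerivWithinAt_unique hw't h2 h4
    have h6 := tangentTo_hasMFDerivWithinAt_unique hwt h2 h4
    refine (h5.symm.trans ?_).trans h6
    simp only [ContinuousLinearMap.comp_apply]
    exact congrArg _ h1

lemma isFieldOn_fieldOfForm {S : Set (CB E Q)} {X : ∀ p : CB E Q, TangentSpace (IC E) p}
    (hX : IsFieldOn (IC E) S X) {γ : ∀ q : Q, TangentSpace 𝓘(ℝ, E) q →L[ℝ] ℝ}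
    (hγ : ContMDiff 𝓘(ℝ, E) (IC E) ∞ (formAsMap γ))
    (hγS : ∀ q ∈ proj E Q '' S, formAsMap γ q ∈ S) :
    IsFieldOn 𝓘(ℝ, E) (proj E Q '' S) (fieldOfForm X γ) := by
  refine ⟨fun q hq => ?_, ?_⟩
  · exact mapsTo_tangentTo (p := formAsMap γ q) (hX.1 _ (hγS q hq))
      contMDiff_projection.contMDiffAt.contMDiffWithinAt
      (eventually_nhdsWithin_of_forall fun x hx => mem_image_of_mem _ hx)
      (contMDiff_projection.mdifferentiable (by simp) _).hasMFDerivAt.hasMFDerivWithinAt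
  · exact (contMDiffOn_tangentMap_proj hX).comp hγ.contMDiffOn hγS

/-- The Hamilton-Jacobi theorem: `X` is tangent to the image of a closed 1-form `γ` at the points
where `d(h ∘ γ) = 0`. -/
lemma mfderiv_form_fieldOfForm (hL : ContMDiff (IT E) 𝓘(ℝ, ℝ) ∞ L) (hreg : AlmostRegular L)
    {X : ∀ p : CB E Q, TangentSpace (IC E) p}
    {γ : ∀ q : Q, TangentSpace 𝓘(ℝ, E) q →L[ℝ] ℝ}
    (hγ : ContMDiff 𝓘(ℝ, E) (IC E) ∞ (formAsMap γ)) (hγM : ∀ q, formAsMap γ q ∈ primary L) (q : Q)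
    (hX : SolvesHamilton L (formAsMap γ q) (X (formAsMap γ q)))
    (hHJ : mfderiv 𝓘(ℝ, E) 𝓘(ℝ, ℝ) (fun q => hamiltonian₁ L (formAsMap γ q)) q = 0)
    (hclosed : ∀ u v : TangentSpace 𝓘(ℝ, E) q, extDer 𝓘(ℝ, E) γ q u v = 0) :
    mfderiv 𝓘(ℝ, E) (IC E) (formAsMap γ) q (fieldOfForm X γ q) = X (formAsMap γ q) := by
  set φ := extChartAt 𝓘(ℝ, E) q with hφ
  set G : E → E →L[ℝ] ℝ := fun y => (cchart q (formAsMap γ (φ.symm y))).2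
  have hsymm : ContMDiffAt 𝓘(ℝ, E) 𝓘(ℝ, E) ∞ φ.symm (φ q) :=
    (contMDiffOn_extChartAt_symm (n := ∞) q).contMDiffAt (extChartAt_target_mem_nhds q)
  have hφq : φ.symm (φ q) = q := extChartAt_to_inv q
  have hG : ContDiffAt ℝ ∞ G (φ q) := by
    have h1 : ContMDiffAt 𝓘(ℝ, E) 𝓘(ℝ, E × (E →L[ℝ] ℝ)) ∞
        (fun y => cchart q (formAsMap γ (φ.symm y))) (φ q) := by
      refine ContMDiffAt.comp (g := cchart q) _ ?_ (hγ.contMDiffAt.comp _ hsymm)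
      refine contMDiffAt_cchart q ?_
      change φ.symm (φ q) ∈ (chartAt E q).source
      rw [hφq]
      exact mem_chart_source E q
    exact contDiffAt_snd.comp _ h1.contDiffAt
  have hGd : HasFDerivAt G (fderiv ℝ G (φ q)) (φ q) :=
    (hG.differentiableAt (by simp)).hasFDerivAt
  have hsrc : ∀ y ∈ φ.target, φ.symm y ∈ (chartAt E q).source := fun y hy => by
    simpa [hφ] using φ.map_target hy
  have hcc : ∀ y ∈ φ.target, cchart q (formAsMap γ (φ.symm y)) = (y, G y) := fun y hy => by
    refine Prod.ext ?_ rfl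
    rw [cchart_apply q (formAsMap γ (φ.symm y)) (hsrc y hy)]
    exact φ.right_inv hy
  have hγd : HasMFDerivAt 𝓘(ℝ, E) (IC E) (formAsMap γ) q
      ((ContinuousLinearMap.id ℝ E).prod (fderiv ℝ G (φ q))) := by
    refine hasMFDerivAt_of_written (g := fun y => (y, G y)) hγ.continuous.continuousAt
      ((hasFDerivAt_id _).prodMk hGd) ?_
    filter_upwards [extChartAt_target_mem_nhds (I := 𝓘(ℝ, E)) q] with y hy
    rw [extChartAt_cotangent]
    exact hcc y hy
  have hγu : ∀ u : E, mfderiv 𝓘(ℝ, E) (IC E) (formAsMap γ) q u =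
      ((u, fderiv ℝ G (φ q) u) : E × (E →L[ℝ] ℝ)) := fun u => by
    rw [hγd.mfderiv]
    rfl
  -- `G` is the coefficient function of `γ` in the chart; closedness says that its derivative is
  -- symmetric.
  have hsym : ∀ u v : E, fderiv ℝ G (φ q) u v = fderiv ℝ G (φ q) v u := fun u v => by
    refine sub_eq_zero.1 (Eq.trans ?_ (hclosed u v))
    refine (extDer_eq_of_eventuallyEq (by simp) γ q G ?_ u v).symm
    filter_upwards [extChartAt_target_mem_nhds (I := 𝓘(ℝ, E)) q] with y hy
    have h1 := TangentBundle.symmL_trivializationAt (I := 𝓘(ℝ, E)) (hsrc y hy)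
    rw [← hφ, φ.right_inv hy] at h1
    have h2 := congrArg Prod.snd (cchart_apply q (formAsMap γ (φ.symm y)) (hsrc y hy))
    refine ContinuousLinearMap.ext fun z => ?_
    have h3 := DFunLike.congr_fun h1 z
    refine Eq.trans ?_ (DFunLike.congr_fun h2 z).symm
    exact congrArg (γ (φ.symm y)) h3.symm
  obtain ⟨Z, hZ⟩ : ∃ Z : E × (E →L[ℝ] ℝ), Z = X (formAsMap γ q) := ⟨_, rfl⟩
  have hfield : fieldOfForm X γ q = Z.1 := by
    rw [hZ, fieldOfForm, (hasMFDerivAt_proj (⟨q, γ q⟩ : CB E Q)).mfderiv]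
    rfl
  have hh : HasMFDerivWithinAt (IC E) 𝓘(ℝ, ℝ) (hamiltonian₁ L) (primary L) (formAsMap γ q) _ :=
    ((contMDiffOn_hamiltonian₁ hL hreg).mdifferentiableOn (by simp) _ (hγM q)).hasMFDerivWithinAt
  have hhγ := (HasMFDerivWithinAt.comp q hh hγd.hasMFDerivWithinAt
    (s := univ) (fun x _ => hγM x)).hasMFDerivAt univ_mem
  -- Hamilton's equation tested on $T\gamma(u)=(u,DG\,u)$ reads
  -- $DG(u)(Z_1)-Z_2(u)=d(h_1\circ\gamma)(u)=0$. With the symmetry of $DG$ this becomes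
  -- $Z_2=DG(Z_1)$.
  have hpair : ∀ u : E, fderiv ℝ G (φ q) u Z.1 = Z.2 u := fun u => by
    have h1 : mfderiv 𝓘(ℝ, E) (IC E) (formAsMap γ) q u ∈
        tangentTo (IC E) (primary L) (formAsMap γ q) :=
      mapsTo_tangentTo (S := univ) (mem_tangentTo_univ (by simp) q u)
        hγ.contMDiffAt.contMDiffWithinAt (eventually_nhdsWithin_of_forall fun x _ => hγM x)
        (hγ.mdifferentiable (by simp) q).hasMFDerivAt.hasMFDerivWithinAt
    have h2 := hX _ h1
    have h3 : mfderivWithin (IC E) 𝓘(ℝ, ℝ) (hamiltonian₁ L) (primary L) (formAsMap γ q)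
        (mfderiv 𝓘(ℝ, E) (IC E) (formAsMap γ) q u) = (0 : ℝ) := by
      have h4 := DFunLike.congr_fun (hhγ.mfderiv.symm.trans hHJ) u
      rw [hγd.mfderiv]
      exact h4
    have h4 := h2.trans h3
    rw [hγu u] at h4
    have h5 := omegaQ_apply (formAsMap γ q) Z ((u, fderiv ℝ G (φ q) u) : E × (E →L[ℝ] ℝ))
    rw [hZ] at h5 ⊢
    exact sub_eq_zero.1 (h5.symm.trans h4)
  rw [hfield, hγu]
  refine Eq.trans ?_ hZ
  refine Prod.ext rfl (ContinuousLinearMap.ext fun u => ?_)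
  exact (hsym _ _).trans (hpair u)

end

end SingularHJ

end

/-! ### Proof of the theorem -/

theorem mainTheorem6
    {E : Type*} [NormedAddCommGroup E] [NormedSpace ℝ E] [FiniteDimensional ℝ E]
    {Q : Type*} [TopologicalSpace Q] [T2Space Q] [SecondCountableTopology Q]
    [ChartedSpace E Q] [IsManifold 𝓘(ℝ, E) ∞ Q]
    -- the Lagrangian
    (L : SingularHJ.TB E Q → ℝ)
    (hL : ContMDiff (SingularHJ.IT E) 𝓘(ℝ, ℝ) ∞ L)
    (hreg : SingularHJ.AlmostRegular L)
    -- the constraint algorithm yields submanifolds and stabilizes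
    (k : ℕ)
    (hM : ∀ l ≤ k, SingularHJ.IsSubmanifold (SingularHJ.IC E) (SingularHJ.M L l))
    (hk : SingularHJ.M L (k + 1) = SingularHJ.M L k)
    (Mf : Set (SingularHJ.CB E Q)) (hMf : Mf = SingularHJ.M L k)
    (Pf : Set (SingularHJ.TB E Q)) (hPf : Pf = SingularHJ.P L k)
    (Qf : Set Q) (hQf : Qf = SingularHJ.proj E Q '' Mf)
    (hQf_sub : SingularHJ.IsSubmanifold 𝓘(ℝ, E) Qf)
    -- a solution of the equations of motion on the final constraint submanifold
    (X : ∀ p : SingularHJ.CB E Q, TangentSpace (SingularHJ.IC E) p)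
    (hX : SingularHJ.IsFieldOn (SingularHJ.IC E) Mf X)
    (hX_sol : ∀ p ∈ Mf, SingularHJ.SolvesHamilton L p (X p))
    -- a solution of the Hamilton-Jacobi problem
    (γ : ∀ q : Q, TangentSpace 𝓘(ℝ, E) q →L[ℝ] ℝ)
    (hγ : ContMDiff 𝓘(ℝ, E) (SingularHJ.IC E) ∞ (SingularHJ.formAsMap γ))
    (hγ_M₁ : ∀ q, SingularHJ.formAsMap γ q ∈ SingularHJ.primary L)
    (hγ_Mf : ∀ q ∈ Qf, SingularHJ.formAsMap γ q ∈ Mf)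
    (hγ_HJ : ∀ q ∈ Qf,
      mfderiv 𝓘(ℝ, E) 𝓘(ℝ, ℝ) (fun q => SingularHJ.hamiltonian₁ L (SingularHJ.formAsMap γ q)) q = 0)
    (hγ_closed : ∀ q (u v : TangentSpace 𝓘(ℝ, E) q), SingularHJ.extDer 𝓘(ℝ, E) γ q u v = 0)
    -- a projectable vector field on `Pf` which projects on `X`
    (ξ : ∀ v : SingularHJ.TB E Q, TangentSpace (SingularHJ.IT E) v)
    (hξ : SingularHJ.IsFieldOn (SingularHJ.IT E) Pf ξ)
    (hξ_proj : ∀ v ∈ Pf,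
      mfderiv (SingularHJ.IT E) (SingularHJ.IC E) (SingularHJ.FL L) v (ξ v)
        = X (SingularHJ.FL L v))
    -- the section `β_ξ`, the field `X_ξ` along its image, and the field `X^γ` on `Qf`
    (β : SingularHJ.CB E Q → SingularHJ.TB E Q) (hβ : β = SingularHJ.beta L Pf ξ)
    (Xξ : SingularHJ.TB E Q → TangentBundle (SingularHJ.IT E) (SingularHJ.TB E Q))
    (hXξ : Xξ = SingularHJ.sodeField L Mf β X)
    (Xγ : ∀ q : Q, TangentSpace 𝓘(ℝ, E) q) (hXγ : Xγ = SingularHJ.fieldOfForm X γ) :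
    -- `β_ξ` is a smooth section of `FL : Pf → Mf`
    (ContMDiffOn (SingularHJ.IC E) (SingularHJ.IT E) ∞ β Mf ∧
      ∀ p ∈ Mf, β p ∈ Pf ∧ SingularHJ.FL L (β p) = p) ∧
    -- `X_ξ` is the unique vector field on `Im β_ξ` satisfying Euler-Lagrange and SODE
    (∀ p ∈ Mf, ∃ w : TangentSpace (SingularHJ.IT E) (β p), Xξ (β p) = ⟨β p, w⟩ ∧
      w ∈ SingularHJ.tangentTo (SingularHJ.IT E) (β '' Mf) (β p) ∧
      SingularHJ.SolvesEL L (β p) w ∧ SingularHJ.IsSODE (β p) w ∧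
      ∀ w' ∈ SingularHJ.tangentTo (SingularHJ.IT E) (β '' Mf) (β p),
        SingularHJ.SolvesEL L (β p) w' → SingularHJ.IsSODE (β p) w' → w' = w) ∧
    -- `X^γ` is a smooth vector field on `Qf`
    SingularHJ.IsFieldOn 𝓘(ℝ, E) Qf Xγ ∧
    -- `X_ξ` and `X^γ` are related by `X^γ = β_ξ ∘ γ_f`, and `X_ξ` is the complete lift of `X^γ`
    -- along the image of `X^γ`, where it satisfies Euler-Lagrange and SODE
    ∀ q ∈ Qf,
      β (SingularHJ.formAsMap γ q) = SingularHJ.asMap Xγ q ∧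
      Xξ (β (SingularHJ.formAsMap γ q)) =
        tangentMapWithin 𝓘(ℝ, E) (SingularHJ.IT E) (SingularHJ.asMap Xγ) Qf
          (SingularHJ.asMap Xγ q) ∧
      Xξ (β (SingularHJ.formAsMap γ q)) =
        SingularHJ.completeLift Qf Xγ (SingularHJ.asMap Xγ q) ∧
      SingularHJ.SolvesEL L (SingularHJ.asMap Xγ q)
        (mfderivWithin 𝓘(ℝ, E) (SingularHJ.IT E) (SingularHJ.asMap Xγ) Qf q (Xγ q)) ∧
      SingularHJ.IsSODE (SingularHJ.asMap Xγ q)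
        (mfderivWithin 𝓘(ℝ, E) (SingularHJ.IT E) (SingularHJ.asMap Xγ) Qf q (Xγ q)) := by
  subst hβ hXξ hXγ hMf hPf hQf
  have hMP : SingularHJ.M L k ⊆ SingularHJ.primary L := SingularHJ.M_subset_primary L k
  rw [SingularHJ.P_eq_preimage_M hL hreg] at hξ_proj ⊢
  set S := SingularHJ.M L k
  set β := SingularHJ.beta L (SingularHJ.FL L ⁻¹' S) ξ
  have hβ : ∀ p ∈ S, β p = tangentMap (SingularHJ.IC E) 𝓘(ℝ, E) (SingularHJ.proj E Q) ⟨p, X p⟩ :=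
    fun p hp => SingularHJ.beta_apply hMP hL hξ_proj hp
  have hvel : ∀ p ∈ S, β p = ⟨p.proj, (X p : E × (E →L[ℝ] ℝ)).1⟩ := fun p hp =>
    (hβ p hp).trans (SingularHJ.tangentMap_proj_apply p (X p))
  have hsec : ∀ p ∈ S, SingularHJ.FL L (β p) = p := fun p hp => by
    rw [hβ p hp]
    exact SingularHJ.FL_tangentMap_proj hL hreg (hMP hp) X (hX_sol p hp)
  have hβs : ContMDiffOn (SingularHJ.IC E) (SingularHJ.IT E) ∞ β S :=
    (SingularHJ.contMDiffOn_tangentMap_proj hX).congr hβ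
  have hsode : ∀ p ∈ S, _ := fun p hp =>
    SingularHJ.sodeField_unique_solution hL hreg hβs hsec hX.1 hX_sol hvel hp
  have hfield := SingularHJ.isFieldOn_fieldOfForm hX hγ hγ_Mf
  set Xγ := SingularHJ.fieldOfForm X γ
  have hβγ : ∀ q ∈ SingularHJ.proj E Q '' S,
      β (SingularHJ.formAsMap γ q) = SingularHJ.asMap Xγ q := fun q hq => hβ _ (hγ_Mf q hq)
  refine ⟨⟨hβs, fun p hp => ⟨?_, hsec p hp⟩⟩, hsode, hfield, fun q hq => ?_⟩
  · rwa [mem_preimage, hsec p hp]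
  have hp := hγ_Mf q hq
  -- The chain rule for $X^\gamma=\beta_\xi\circ\gamma$ on $Q_f$, together with
  -- $T\gamma(X^\gamma)=X\circ\gamma$. The derivatives within $Q_f$ are compared only on
  -- $X^\gamma(q)$, which is tangent to $Q_f$.
  have hT : SingularHJ.sodeField L S β X (β (SingularHJ.formAsMap γ q)) =
      tangentMapWithin 𝓘(ℝ, E) (SingularHJ.IT E) (SingularHJ.asMap Xγ)
        (SingularHJ.proj E Q '' S) (SingularHJ.asMap Xγ q) := by
    have h1 : ∀ p' : SingularHJ.CB E Q, p' = SingularHJ.formAsMap γ q →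
        tangentMapWithin (SingularHJ.IC E) (SingularHJ.IT E) β S ⟨p', X p'⟩ =
        tangentMapWithin (SingularHJ.IC E) (SingularHJ.IT E) β S
          ⟨SingularHJ.formAsMap γ q, X (SingularHJ.formAsMap γ q)⟩ := by
      rintro _ rfl
      rfl
    refine (h1 _ (hsec _ hp)).trans ?_
    have h2 := SingularHJ.mfderiv_form_fieldOfForm hL hreg hγ hγ_M₁ q (hX_sol _ hp) (hγ_HJ q hq)
      (hγ_closed q)
    have h3 := HasMFDerivWithinAt.comp q
      (hβs.mdifferentiableOn (by simp) _ hp).hasMFDerivWithinAt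
      (hγ.mdifferentiable (by simp) q).hasMFDerivAt.hasMFDerivWithinAt hγ_Mf
    have h4 : HasMFDerivWithinAt 𝓘(ℝ, E) (SingularHJ.IT E) (β ∘ SingularHJ.formAsMap γ)
        (SingularHJ.proj E Q '' S) q (mfderivWithin 𝓘(ℝ, E) (SingularHJ.IT E)
          (SingularHJ.asMap Xγ) (SingularHJ.proj E Q '' S) q) :=
      (hfield.2.mdifferentiableOn (by simp) q hq).hasMFDerivWithinAt.congr_of_eventuallyEq
        (eventually_nhdsWithin_of_forall hβγ) (hβγ q hq)
    have h5 := SingularHJ.tangentTo_hasMFDerivWithinAt_unique (hfield.1 q hq) h3 h4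
    have h6 : ∀ (v v' : SingularHJ.TB E Q) (w w' : E × E), v = v' → w = w' →
        (⟨v, w⟩ : TangentBundle (SingularHJ.IT E) (SingularHJ.TB E Q)) = ⟨v', w'⟩ := by
      rintro _ _ _ _ rfl rfl
      rfl
    refine h6 _ _ _ _ (hβγ q hq) (Eq.trans ?_ h5)
    exact congrArg _ h2.symm
  obtain ⟨w, hw, -, hEL, hSODE, -⟩ := hsode _ hp
  have hw' := hw.symm.trans hT
  have hsol : ∀ (v : SingularHJ.TB E Q) (w : TangentSpace (SingularHJ.IT E) v)
      (v' : SingularHJ.TB E Q) (w' : TangentSpace (SingularHJ.IT E) v'),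
      (⟨v, w⟩ : TangentBundle (SingularHJ.IT E) (SingularHJ.TB E Q)) = ⟨v', w'⟩ →
      SingularHJ.SolvesEL L v w → SingularHJ.IsSODE v w →
      SingularHJ.SolvesEL L v' w' ∧ SingularHJ.IsSODE v' w' := by
    rintro v w v' w' h h1 h2
    cases h
    exact ⟨h1, h2⟩
  have hfin := hsol _ _ _ _ hw' hEL hSODE
  refine ⟨hβγ q hq, hT, hT.trans ?_, hfin⟩
  -- The involution exchanges the velocity of the base point with the base component, and these
  -- coincide for a SODE vector.
  have h1 := (SingularHJ.isSODE_iff (SingularHJ.asMap Xγ q) _).1 hfin.2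
  have h2 : ∀ (v : SingularHJ.TB E Q) (w : E × E), w.1 = (v.2 : E) →
      (⟨v, w⟩ : TangentBundle (SingularHJ.IT E) (SingularHJ.TB E Q)) =
        SingularHJ.canonicalFlip ⟨v, w⟩ := by
    rintro ⟨q, u⟩ ⟨w₁, w₂⟩ (rfl : w₁ = u)
    rfl
  exact h2 _ _ h1
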